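/- For $a\in\mathbb{N}$, real $\alpha>0$, $\eta>0$ and $\mu,p,b,c\in\mathbb{C}$ let $${}_a\mathcal{W}^{\alpha,\mu}_{p,b,c,\eta}(z)=\sum_{k=0}^{\infty}\frac{(-c)^k}{\Gamma(\alpha k+\mu)\,\Gamma\!\left(ak+\frac p\eta+\frac{b+2}{2}\right)}\left(\frac z2\right)^{2k+p+1}$$ be the generalized Struve function. For $\Re\gamma>0$ and $x>0$ let $$\left(I_{0+}^{\lambda,\lambda',\xi,\xi',\gamma}f\right)(x)=\frac{x^{-\lambda}}{\Gamma(\gamma)}\int_0^x (x-t)^{\gamma-1}t^{-\lambda'}F_3\!\left(\lambda,\lambda',\xi,\xi';\gamma;1-\tfrac tx,1-\tfrac xt\right)f(t)\,dt,$$ where $F_3$ is the (analytically continued) Appell function, $F_3(a,a',b,b';c;x,y)=\sum_{m,n\ge0}\frac{(a)_m(a')_n(b)_m(b')_n}{(c)_{m+n}\,m!\,n!}x^my^n$ for $|x|,|y|<1$, and let $$\left(D_{0+}^{\lambda,\lambda',\xi,\xi',\gamma}f\right)(x)=\left(\frac{d}{dx}\right)^{n}\left(I_{0+}^{-\lambda',-\lambda,-\xi'+n,-\xi,-\gamma+n}f\right)(x),\qquad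 n=[\Re\gamma]+1,$$ be the left-sided Marichev–Saigo–Maeda fractional derivative. Finally let $${}_r\Psi_s\!\left[\begin{matrix}(a_i,\alpha_i)_{1,r}\\(b_j,\beta_j)_{1,s}\end{matrix}\,\middle|\,z\right]=\sum_{k=0}^\infty\frac{\prod_{i=1}^r\Gamma(a_i+\alpha_ik)}{\prod_{j=1}^s\Gamma(b_j+\beta_jk)}\frac{z^k}{k!}$$ be the Fox–Wright function ($1/\Gamma$ is $0$ at the poles of $\Gamma$). Theorem. Let $\lambda,\lambda',\xi,\xi',\gamma,\rho,p,b,c,\mu\in\mathbb{C}$ with $\Re\gamma>0$, $a\in\mathbb{N}$, $\alpha,\eta>0$ and $x>0$. Then $$\left(D_{0+}^{\lambda,\lambda',\xi,\xi',\gamma}\,t^{\rho-1}{}_a\mathcal{W}^{\alpha,\mu}_{p,b,c,\eta}(t)\right)(x)=\frac{x^{\lambda+\lambda'-\gamma+\rho+p}}{2^{p+1}}\;{}_4\Psi_5\!\left[\begin{matrix}(1,1),\,(\rho+p+1,2),\,(-\xi+\lambda+\rho+p+1,2),\,(\lambda+\lambda'+\xi'-\gamma+\rho+p+1,2)\\(\mu,\alpha),\,\left(\frac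 p\eta+\frac{b+2}{2},a\right),\,(-\xi+\rho+p+1,2),\,(\lambda+\lambda'-\gamma+\rho+p+1,2),\,(\lambda+\xi'-\gamma+\rho+p+1,2)\end{matrix}\,\middle|\,-\frac{cx^2}{4}\right],$$ provided both sides exist, that is: the integral defining $I_{0+}^{-\lambda',-\lambda,-\xi'+n,-\xi,-\gamma+n}$ of $t^{\rho-1}{}_a\mathcal{W}^{\alpha,\mu}_{p,b,c,\eta}(t)$ converges absolutely at all points of a neighbourhood of $x$, and none of the Gamma functions in the numerators of the Fox–Wright series is evaluated at a pole. (The $n$-fold differentiability at $x$ and the convergence of the Fox–Wright series then hold automatically and are part of the claim.) -/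

import Mathlib

open Filter Topology

noncomputable section

/-- The Gauss hypergeometric function `₂F₁(a, b; c; z)`: the power series on the unit disc, and
its analytic continuation `(1 - z)^(-a) ₂F₁(a, c - b; c; z / (z - 1))` at the points of the
half-plane `Re z < 1/2` outside the disc (only such points are ever used). -/
def gaussF (a b c z : ℂ) : ℂ :=
  open Classical in
  if ‖z‖ < 1 then ordinaryHypergeometric a b c z
  else (1 - z) ^ (-a) * ordinaryHypergeometric a (c - b) c (z / (z - 1))

/-- The Appell function `F₃(a, a', b, b'; c; x, y)` for `|x| < 1`. The double series
`∑ₘ ∑ₙ (a)ₘ (a')ₙ (b)ₘ (b')ₙ / ((c)ₘ₊ₙ m! n!) xᵐ yⁿ` is summed over `n` first, using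
`(c)ₘ₊ₙ = (c)ₘ (c + m)ₙ`; the inner sum is a Gauss function of `y`, which continues `F₃`
analytically in `y`, in particular to all real `y < 1`. -/
def appellF3 (a a' b b' c x y : ℂ) : ℂ :=
  ∑' m : ℕ, (ascPochhammer ℂ m).eval a * (ascPochhammer ℂ m).eval b /
    ((ascPochhammer ℂ m).eval c * (m.factorial : ℂ)) * x ^ m * gaussF a' b' (c + m) y

/-- Inside the bidisc `appellF3` is the double series that defines the Appell function. -/
theorem appellF3_eq_series (a a' b b' c x y : ℂ) (hy : ‖y‖ < 1) :
    appellF3 a a' b b' c x y =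
      ∑' (m : ℕ) (n : ℕ),
        (ascPochhammer ℂ m).eval a * (ascPochhammer ℂ n).eval a' *
          (ascPochhammer ℂ m).eval b * (ascPochhammer ℂ n).eval b' /
          ((ascPochhammer ℂ (m + n)).eval c * (m.factorial : ℂ) * (n.factorial : ℂ)) *
          x ^ m * y ^ n := by
  unfold appellF3 gaussF
  refine tsum_congr fun m => ?_
  rw [if_pos hy, ordinaryHypergeometric_eq_tsum, ← tsum_mul_left]
  refine tsum_congr fun n => ?_
  have h : (ascPochhammer ℂ (m + n)).eval c =
      (ascPochhammer ℂ m).eval c * (ascPochhammer ℂ n).eval (c + m) := by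
    rw [← ascPochhammer_mul]
    simp
  rw [h]
  simp only [smul_eq_mul, div_eq_mul_inv, mul_inv]
  ring

/-- The integrand of the left-sided Marichev–Saigo–Maeda integral at the point `x`. -/
def msmIntegrand (l l' ξ ξ' γ : ℂ) (f : ℝ → ℂ) (x t : ℝ) : ℂ :=
  ((x - t : ℝ) : ℂ) ^ (γ - 1) * (t : ℂ) ^ (-l') *
    appellF3 l l' ξ ξ' γ ((1 - t / x : ℝ) : ℂ) ((1 - x / t : ℝ) : ℂ) * f t

/-- The integral that defines the left-sided Marichev–Saigo–Maeda integral of `f` at `x`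
converges. -/
def MSMIntegralExists (l l' ξ ξ' γ : ℂ) (f : ℝ → ℂ) (x : ℝ) : Prop :=
  MeasureTheory.IntegrableOn (msmIntegrand l l' ξ ξ' γ f x) (Set.Ioo 0 x)

/-- The left-sided Marichev–Saigo–Maeda fractional integral `I_{0+}^{l, l', ξ, ξ', γ} f`. -/
def msmIntegral (l l' ξ ξ' γ : ℂ) (f : ℝ → ℂ) (x : ℝ) : ℂ :=
  (x : ℂ) ^ (-l) / Complex.Gamma γ * ∫ t in Set.Ioo 0 x, msmIntegrand l l' ξ ξ' γ f x t

/-- The order `[Re γ] + 1` of the outer derivative in `D_{0+}^{l, l', ξ, ξ', γ}`. -/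
def msmOrder (γ : ℂ) : ℕ := ⌊γ.re⌋₊ + 1

/-- The fractional integral `I_{0+}^{-l', -l, -ξ' + n, -ξ, -γ + n} f`, `n = [Re γ] + 1`,
whose `n`-th derivative is `D_{0+}^{l, l', ξ, ξ', γ} f`. -/
def msmDerivInner (l l' ξ ξ' γ : ℂ) (f : ℝ → ℂ) (x : ℝ) : ℂ :=
  msmIntegral (-l') (-l) (-ξ' + msmOrder γ) (-ξ) (-γ + msmOrder γ) f x

/-- Convergence at `x` of the integral in `msmDerivInner`. -/
def MSMDerivInnerExists (l l' ξ ξ' γ : ℂ) (f : ℝ → ℂ) (x : ℝ) : Prop :=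
  MSMIntegralExists (-l') (-l) (-ξ' + msmOrder γ) (-ξ) (-γ + msmOrder γ) f x

/-- The left-sided Marichev–Saigo–Maeda fractional derivative `D_{0+}^{l, l', ξ, ξ', γ} f`. -/
def msmDeriv (l l' ξ ξ' γ : ℂ) (f : ℝ → ℂ) (x : ℝ) : ℂ :=
  iteratedDeriv (msmOrder γ) (msmDerivInner l l' ξ ξ' γ f) x

/-- The generalized Struve function `ₐW_{p,b,c,η}^{α,μ}(z)`. (A factor `1 / Γ` at a pole of `Γ`
is `0`, in agreement with `Complex.Gamma` being `0` there.) -/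
def genStruve (a : ℕ) (α : ℝ) (μ p b c : ℂ) (η : ℝ) (z : ℂ) : ℂ :=
  ∑' k : ℕ, (-c) ^ k /
    (Complex.Gamma (α * k + μ) * Complex.Gamma (a * k + p / η + (b + 2) / 2)) *
    (z / 2) ^ (2 * k + p + 1)

/-- The `k`-th term of the Fox–Wright series with upper parameters `A` and lower parameters `B`,
each a pair (shift, slope). -/
def foxWrightTerm {m n : ℕ} (A : Fin m → ℂ × ℝ) (B : Fin n → ℂ × ℝ) (z : ℂ) (k : ℕ) : ℂ :=
  (∏ i, Complex.Gamma ((A i).1 + (A i).2 * k)) / (∏ j, Complex.Gamma ((B j).1 + (B j).2 * k)) *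
    (z ^ k / (k.factorial : ℂ))

/-- No Gamma factor in a numerator of the Fox–Wright series is taken at a pole. -/
def FoxWrightTermsExist {m : ℕ} (A : Fin m → ℂ × ℝ) : Prop :=
  ∀ (i : Fin m) (k j : ℕ), (A i).1 + (A i).2 * k ≠ -(j : ℂ)

/-- The Fox–Wright function `ₘΨₙ`. -/
def foxWright {m n : ℕ} (A : Fin m → ℂ × ℝ) (B : Fin n → ℂ × ℝ) (z : ℂ) : ℂ :=
  ∑' k : ℕ, foxWrightTerm A B z k

/-- The upper parameters of the Fox–Wright function in the image formula. -/
def upperParams (l l' ξ ξ' γ ρ p : ℂ) : Fin 4 → ℂ × ℝ :=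
  ![(1, 1), (ρ + p + 1, 2), (-ξ + l + ρ + p + 1, 2), (l + l' + ξ' - γ + ρ + p + 1, 2)]

/-- The lower parameters of the Fox–Wright function in the image formula. -/
def lowerParams (l l' ξ ξ' γ ρ p b μ : ℂ) (α η : ℝ) (a : ℕ) : Fin 5 → ℂ × ℝ :=
  ![(μ, α), (p / η + (b + 2) / 2, a), (-ξ + ρ + p + 1, 2), (l + l' - γ + ρ + p + 1, 2),
    (l + ξ' - γ + ρ + p + 1, 2)]

end

/-!
Expand the product of the Struve function with `t ^ (ρ - 1)` into powers
`t ^ (ρ + p + 2 * k)`. The fractional integral of a power is a power, and its coefficient is the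
value of the Mellin transform over `(0, 1)` of the kernel
`(1 - u) ^ (G - 1) * u ^ (-L') * F₃(L, L', X, X'; G; 1 - u, 1 - 1 / u)`, so everything rests on
that transform. Pfaff's transformation turns `u ^ (-L') * F₃` into a power series in `1 - u`; when
`Re s` is large its terms give beta integrals, and summing them by Gauss's theorem, once in each
variable, yields a quotient of Gamma functions. By analytic continuation, and continuity up to the
boundary line, the formula persists wherever the Mellin integral converges absolutely.

Only the existence of the fractional integral of the whole series at one point is given. Near `0`
the series behaves like its first nonzero term, so that existence is the absolute convergence of the
Mellin integral at the exponent of that term, hence at every later exponent. The rapid growth of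
`Γ(α k + μ)` then justifies integrating and differentiating term by term, and the `n`-fold
derivative replaces `1 / Γ(s + n)` by `1 / Γ(s)`, which gives the Fox–Wright terms.
-/

open Finset.HasAntidiagonal (antidiagonal mem_antidiagonal)

/-- The rising factorial `(a)ₙ = a (a + 1) ⋯ (a + n - 1)`, in terms of which all the hypergeometric
coefficients below are written. -/
noncomputable def poch {R : Type*} [CommRing R] (a : R) (n : ℕ) : R := (ascPochhammer R n).eval a

section Pochhammer

variable {R : Type*} [CommRing R]

@[simp] theorem poch_zero (a : R) : poch a 0 = 1 := by simp [poch]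

theorem poch_succ (a : R) (n : ℕ) : poch a (n + 1) = poch a n * (a + n) := by
  simp [poch, ascPochhammer_succ_eval]

theorem poch_add (a : R) (m n : ℕ) : poch a (m + n) = poch a m * poch (a + m) n := by
  simp [poch, ← ascPochhammer_mul]

theorem poch_succ' (a : R) (n : ℕ) : poch a (n + 1) = a * poch (a + 1) n := by
  rw [add_comm, poch_add]
  simp [poch_succ]

theorem poch_one_left (n : ℕ) : poch (1 : R) n = n.factorial := by
  simp [poch, ascPochhammer_eval_one]

theorem map_poch {S : Type*} [CommRing S] (φ : R →+* S) (a : R) (n : ℕ) :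
    φ (poch a n) = poch (φ a) n := by
  induction n with
  | zero => simp
  | succ n ih => simp [poch_succ, ih]

theorem chu_vandermonde_poch (N : ℕ) (c d : R) :
    ∑ p ∈ antidiagonal N,
        (N.choose p.1 : R) * ((-1) ^ p.1 * poch d p.1 * poch (c + p.1) p.2) = poch (c - d) N := by
  induction N generalizing c d with
  | zero => simp
  | succ N ih =>
    have hfix : ∑ p ∈ antidiagonal N,
        (N.choose p.1 : R) * ((-1) ^ p.1 * poch d p.1 * poch (c + p.1) (p.2 + 1)) =
          (c + N) * poch (c - d) N := by
      rw [← ih, Finset.mul_sum]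
      refine Finset.sum_congr rfl fun p hp => ?_
      rw [← mem_antidiagonal.1 hp, poch_succ]
      push_cast
      ring
    have hshift : ∑ p ∈ antidiagonal N,
        (N.choose p.2 : R) * ((-1) ^ (p.1 + 1) * poch d (p.1 + 1) *
          poch (c + (p.1 + 1 : ℕ)) p.2) = -d * poch (c - d) N := by
      rw [← add_sub_add_right_eq_sub c d 1, ← ih, Finset.mul_sum]
      refine Finset.sum_congr rfl fun p hp => ?_
      rw [Nat.choose_symm_of_eq_add (mem_antidiagonal.1 hp).symm, poch_succ' d, pow_succ,
        Nat.cast_succ, add_comm (p.1 : R) 1, add_assoc c]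
      ring
    rw [Finset.sum_antidiagonal_choose_succ_mul
      (fun i j => (-1) ^ i * poch d i * poch (c + i) j), hfix, hshift, poch_succ]
    ring

theorem poch_pos {r : ℝ} (hr : 0 < r) (n : ℕ) : 0 < poch r n := ascPochhammer_pos n r hr

theorem poch_nonneg {r : ℝ} (hr : 0 ≤ r) (n : ℕ) : 0 ≤ poch r n := by
  induction n with
  | zero => simp
  | succ n ih => rw [poch_succ]; positivity

theorem poch_mono {r s : ℝ} (hr : 0 ≤ r) (h : r ≤ s) (n : ℕ) : poch r n ≤ poch s n := by
  induction n with
  | zero => simp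
  | succ n ih =>
    rw [poch_succ, poch_succ]
    exact mul_le_mul ih (by linarith) (by positivity) (poch_nonneg (hr.trans h) n)

theorem norm_poch_le {a : ℂ} {r : ℝ} (h : ‖a‖ ≤ r) (n : ℕ) : ‖poch a n‖ ≤ poch r n := by
  induction n with
  | zero => simp
  | succ n ih =>
    rw [poch_succ, poch_succ, norm_mul]
    refine mul_le_mul ih ((norm_add_le _ _).trans ?_) (norm_nonneg _)
      (poch_nonneg ((norm_nonneg a).trans h) n)
    simpa using h

theorem poch_le_norm_poch {a : ℂ} {r : ℝ} (hr : 0 ≤ r) (h : r ≤ a.re) (n : ℕ) :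
    poch r n ≤ ‖poch a n‖ := by
  induction n with
  | zero => simp
  | succ n ih =>
    rw [poch_succ, poch_succ, norm_mul]
    refine mul_le_mul ih (le_trans ?_ (Complex.re_le_norm _)) (by positivity) (norm_nonneg _)
    simpa using h

theorem norm_poch_ofReal {r : ℝ} (hr : 0 ≤ r) (n : ℕ) : ‖poch (r : ℂ) n‖ = poch r n :=
  le_antisymm (norm_poch_le (by simp [abs_of_nonneg hr]) n) (poch_le_norm_poch hr (by simp) n)

theorem poch_ne_zero {a : ℂ} (h : 0 < a.re) (n : ℕ) : poch a n ≠ 0 :=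
  norm_pos_iff.1 ((poch_pos h n).trans_le (poch_le_norm_poch h.le le_rfl n))

theorem Gamma_inv_eq_poch_mul (a : ℂ) (n : ℕ) :
    (Complex.Gamma a)⁻¹ = poch a n * (Complex.Gamma (a + n))⁻¹ := by
  induction n with
  | zero => simp
  | succ n ih =>
    rw [ih, Complex.one_div_Gamma_eq_self_mul_one_div_Gamma_add_one (a + n), poch_succ]
    push_cast
    ring_nf

theorem Gamma_add_nat_eq_poch_mul {a : ℂ} (h : 0 < a.re) (n : ℕ) :
    Complex.Gamma (a + n) = poch a n * Complex.Gamma a := by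
  have hΓ := Complex.Gamma_ne_zero_of_re_pos h
  have hΓn : Complex.Gamma (a + n) ≠ 0 :=
    Complex.Gamma_ne_zero_of_re_pos (by simpa using by positivity)
  have hrec := Gamma_inv_eq_poch_mul a n
  field_simp at hrec
  rw [hrec, mul_comm]

theorem poch_natCast_add_one_le (A n : ℕ) :
    poch ((A : ℝ) + 1) n ≤ n.factorial * ((n : ℝ) + 1) ^ A := by
  induction A with
  | zero => simp [poch_one_left]
  | succ A ih =>
    have hA : (0 : ℝ) < A + 1 := by positivity
    have hpoch := poch_nonneg hA.le n
    have hstep : poch ((A : ℝ) + 1 + 1) n ≤ poch ((A : ℝ) + 1) n * (n + 1) := by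
      refine le_of_mul_le_mul_left ?_ hA
      calc ((A : ℝ) + 1) * poch ((A : ℝ) + 1 + 1) n
          = poch ((A : ℝ) + 1) n * (A + 1 + n) := by rw [← poch_succ', poch_succ]
        _ ≤ poch ((A : ℝ) + 1) n * ((A + 1) * (n + 1)) := by
          gcongr
          nlinarith [mul_nonneg (Nat.cast_nonneg (α := ℝ) A) (Nat.cast_nonneg (α := ℝ) n)]
        _ = (A + 1) * (poch ((A : ℝ) + 1) n * (n + 1)) := by ring
    push_cast
    calc poch ((A : ℝ) + 1 + 1) n ≤ poch ((A : ℝ) + 1) n * (n + 1) := hstep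
      _ ≤ n.factorial * ((n : ℝ) + 1) ^ A * (n + 1) := by gcongr
      _ = n.factorial * ((n : ℝ) + 1) ^ (A + 1) := by ring

theorem pow_le_poch {r s : ℝ} (hr : 0 ≤ r) (h : r ≤ s) (n : ℕ) : r ^ n ≤ poch s n := by
  induction n with
  | zero => simp
  | succ n ih =>
    rw [pow_succ, poch_succ]
    exact mul_le_mul ih (by linarith [n.cast_nonneg (α := ℝ)]) hr (poch_nonneg (hr.trans h) n)

theorem pow_mul_poch_le (A T n : ℕ) :
    ((n : ℝ) + 1) ^ T * poch ((A : ℝ) + 1) n ≤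
      poch ((A : ℝ) + 1) T * poch ((A : ℝ) + 1 + T) n := by
  rw [← poch_add, add_comm T n, poch_add, mul_comm]
  exact mul_le_mul_of_nonneg_left
    (pow_le_poch (by positivity) (by linarith [A.cast_nonneg (α := ℝ)]) T)
    (poch_nonneg (by positivity) n)

end Pochhammer

section Gauss

/-- The coefficients of the Gauss hypergeometric series `₂F₁ a b c`, as quotients of rising
factorials; they are `0` once `poch c n` vanishes. -/
noncomputable def gaussCoeff (a b c : ℂ) (n : ℕ) : ℂ :=
  poch a n * poch b n / (poch c n * n.factorial)

theorem gaussCoeff_eq_ordinaryHypergeometricCoefficient (a b c : ℂ) :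
    gaussCoeff a b c = ordinaryHypergeometricCoefficient a b c := by
  ext n
  simp only [gaussCoeff, poch, ordinaryHypergeometricCoefficient, div_eq_mul_inv, mul_inv]
  ring

theorem one_le_radius_ordinaryHypergeometricSeries (a b c : ℂ) :
    1 ≤ (ordinaryHypergeometricSeries ℂ a b c).radius := by
  by_cases! h : ∀ k : ℕ, (k : ℂ) ≠ -a ∧ (k : ℂ) ≠ -b ∧ (k : ℂ) ≠ -c
  · rw [ordinaryHypergeometricSeries_radius_eq_one (𝕂 := ℂ) ℂ a b c h]
  · obtain ⟨k, hk⟩ := h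
    by_cases ha : (k : ℂ) = -a
    · rw [← neg_eq_iff_eq_neg.2 ha, ordinaryHypergeometric_radius_top_of_neg_nat₁]
      exact le_top
    by_cases hb : (k : ℂ) = -b
    · rw [← neg_eq_iff_eq_neg.2 hb, ordinaryHypergeometric_radius_top_of_neg_nat₂]
      exact le_top
    rw [← neg_eq_iff_eq_neg.2 (hk ha hb), ordinaryHypergeometric_radius_top_of_neg_nat₃]
    exact le_top

theorem summable_norm_gaussCoeff_mul_pow (a b c : ℂ) {r : ℝ} (h0 : 0 ≤ r) (hr : r < 1) :
    Summable fun n => ‖gaussCoeff a b c n‖ * r ^ n := by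
  lift r to NNReal using h0
  have h := (ordinaryHypergeometricSeries ℂ a b c).summable_norm_mul_pow (r := r)
    (lt_of_lt_of_le (by exact_mod_cast hr) (one_le_radius_ordinaryHypergeometricSeries a b c))
  refine h.congr fun n => ?_
  rw [ordinaryHypergeometricSeries, FormalMultilinearSeries.ofScalars_norm,
    gaussCoeff_eq_ordinaryHypergeometricCoefficient]

theorem hasSum_gaussCoeff_mul_pow (a b c : ℂ) {z : ℂ} (hz : ‖z‖ < 1) :
    HasSum (fun n => gaussCoeff a b c n * z ^ n) (₂F₁ a b c z) := by
  have hs : Summable (fun n => gaussCoeff a b c n * z ^ n) := by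
    refine Summable.of_norm ?_
    simpa using summable_norm_gaussCoeff_mul_pow a b c (norm_nonneg z) hz
  convert hs.hasSum using 1
  rw [ordinaryHypergeometric_eq_tsum, gaussCoeff_eq_ordinaryHypergeometricCoefficient]
  rfl

theorem analyticOnNhd_ordinaryHypergeometric (a b c : ℂ) :
    AnalyticOnNhd ℂ (₂F₁ a b c : ℂ → ℂ) (Metric.ball 0 1) := by
  have hradius := one_le_radius_ordinaryHypergeometricSeries a b c
  have hball := ((ordinaryHypergeometricSeries ℂ a b c).hasFPowerSeriesOnBall
    (lt_of_lt_of_le one_pos hradius)).mono one_pos hradius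
  have hanalytic := hball.analyticOnNhd
  rwa [← ENNReal.ofReal_one, Metric.eball_ofReal] at hanalytic

theorem hasSum_poch_div_factorial_mul_pow (a : ℂ) {x : ℂ} (hx : ‖x‖ < 1) :
    HasSum (fun n : ℕ => poch a n / n.factorial * x ^ n) ((1 - x) ^ (-a)) := by
  have hbinom := (Complex.one_div_one_sub_cpow_hasFPowerSeriesOnBall_zero a).hasSum (y := x) (by
    rw [← ENNReal.ofReal_one, Metric.eball_ofReal]; simpa using hx)
  rw [zero_add, one_div, ← Complex.cpow_neg] at hbinom
  refine hbinom.congr_fun fun n => ?_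
  have hpoch := Ring.factorial_nsmul_multichoose_eq_ascPochhammer a n
  rw [Polynomial.ascPochhammer_smeval_eq_eval, nsmul_eq_mul] at hpoch
  rw [FormalMultilinearSeries.ofScalars_apply_eq, smul_eq_mul, ← Ring.multichoose_eq, poch,
    ← hpoch, mul_div_cancel_left₀ _ (Nat.cast_ne_zero.2 n.factorial_ne_zero)]

theorem hasSum_poch_div_factorial_mul_pow_real (a : ℝ) {x : ℝ} (h0 : 0 ≤ x) (hx : x < 1) :
    HasSum (fun n : ℕ => poch a n / n.factorial * x ^ n) ((1 - x) ^ (-a)) := by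
  have h := hasSum_poch_div_factorial_mul_pow a (x := x) (by simpa [abs_of_nonneg h0] using hx)
  have hval : ((1 : ℂ) - x) ^ (-(a : ℂ)) = (((1 - x) ^ (-a) : ℝ) : ℂ) := by
    rw [Complex.ofReal_cpow (by linarith)]
    push_cast
    rfl
  rw [hval] at h
  refine Complex.hasSum_ofReal.1 (h.congr_fun fun n => ?_)
  have hcast : poch (a : ℂ) n = (poch a n : ℝ) := (map_poch Complex.ofRealHom a n).symm
  rw [hcast]
  push_cast
  rfl

end Gauss

section Pfaff

/-- The double series behind the Pfaff transformation: its rows are the terms of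
`(1 - y)^(-a) ₂F₁(a, d; c; y / (y - 1))` and its antidiagonals those of `₂F₁(a, c - d; c; y)`. -/
noncomputable def pfaffTerm (a d c y : ℂ) (p : ℕ × ℕ) : ℂ :=
  gaussCoeff a d c p.1 * (-1) ^ p.1 * (poch (a + p.1) p.2 / p.2.factorial) * y ^ (p.1 + p.2)

theorem hasSum_pfaffTerm_row (a d c : ℂ) {y : ℂ} (hy : ‖y‖ < 1) (i : ℕ) :
    HasSum (fun j => pfaffTerm a d c y (i, j))
      ((1 - y) ^ (-a) * (gaussCoeff a d c i * (y / (y - 1)) ^ i)) := by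
  have hy1 : 1 - y ≠ 0 := by
    rw [sub_ne_zero]
    rintro rfl
    simp at hy
  have hrow := (hasSum_poch_div_factorial_mul_pow (a + i) hy).mul_left
    (gaussCoeff a d c i * (-1) ^ i * y ^ i)
  have hval : (1 - y) ^ (-a) * (gaussCoeff a d c i * (y / (y - 1)) ^ i) =
      gaussCoeff a d c i * (-1) ^ i * y ^ i * (1 - y) ^ (-(a + i)) := by
    rw [neg_add, Complex.cpow_add _ _ hy1, Complex.cpow_neg _ (i : ℂ), Complex.cpow_natCast,
      ← neg_sub 1 y, div_neg, neg_pow, div_pow]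
    ring
  rw [hval]
  refine hrow.congr_fun fun j => ?_
  simp only [pfaffTerm, pow_add]
  ring

theorem norm_pfaffTerm_le (a d c y : ℂ) (p : ℕ × ℕ) :
    ‖pfaffTerm a d c y p‖ ≤ ‖gaussCoeff ‖a‖ d c p.1‖ * ‖y‖ ^ p.1 *
      (poch (‖a‖ + p.1) p.2 / p.2.factorial * ‖y‖ ^ p.2) := by
  have hcoeff : ‖gaussCoeff a d c p.1‖ ≤ ‖gaussCoeff ‖a‖ d c p.1‖ := by
    simp only [gaussCoeff, norm_mul, norm_div]
    rw [norm_poch_ofReal (norm_nonneg a)]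
    gcongr
    exact norm_poch_le le_rfl p.1
  have hpoch : ‖poch (a + p.1) p.2‖ ≤ poch (‖a‖ + p.1) p.2 :=
    norm_poch_le ((norm_add_le _ _).trans (by simp)) p.2
  calc ‖pfaffTerm a d c y p‖
      = ‖gaussCoeff a d c p.1‖ * ‖y‖ ^ p.1 *
          (‖poch (a + p.1) p.2‖ / p.2.factorial * ‖y‖ ^ p.2) := by
        simp only [pfaffTerm, norm_mul, norm_div, norm_pow, norm_neg, norm_one, one_pow, mul_one,
          Complex.norm_natCast, pow_add]
        ring
    _ ≤ _ := by gcongr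

theorem summable_pfaffTerm (a d c : ℂ) {y : ℂ} (hy : ‖y‖ < 1 / 2) :
    Summable (pfaffTerm a d c y) := by
  have hy0 : 0 ≤ ‖y‖ := norm_nonneg y
  have hy1 : 0 < 1 - ‖y‖ := by linarith
  have hrow (i : ℕ) := hasSum_poch_div_factorial_mul_pow_real (‖a‖ + i) hy0 (by linarith)
  refine Summable.of_norm_bounded (g := fun p : ℕ × ℕ => ‖gaussCoeff ‖a‖ d c p.1‖ * ‖y‖ ^ p.1 *
    (poch (‖a‖ + p.1) p.2 / p.2.factorial * ‖y‖ ^ p.2)) ?_ (norm_pfaffTerm_le a d c y)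
  rw [summable_prod_of_nonneg fun p => (norm_nonneg _).trans (norm_pfaffTerm_le a d c y p)]
  refine ⟨fun i => (hrow i).summable.mul_left (‖gaussCoeff ‖a‖ d c i‖ * ‖y‖ ^ i), ?_⟩
  simp only [tsum_mul_left, (hrow _).tsum_eq]
  have hgeom := (summable_norm_gaussCoeff_mul_pow ‖a‖ d c (r := ‖y‖ / (1 - ‖y‖)) (by positivity)
    (by rw [div_lt_one hy1]; linarith)).mul_right ((1 - ‖y‖) ^ (-‖a‖))
  refine hgeom.congr fun i => ?_
  rw [neg_add, Real.rpow_add hy1, Real.rpow_neg hy1.le (i : ℝ), Real.rpow_natCast, div_pow]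
  ring

theorem sum_antidiagonal_pfaffTerm (a d : ℂ) {c : ℂ} (hc : ∀ n, poch c n ≠ 0) (y : ℂ) (N : ℕ) :
    ∑ p ∈ antidiagonal N, pfaffTerm a d c y p = gaussCoeff a (c - d) c N * y ^ N := by
  rw [gaussCoeff, ← chu_vandermonde_poch, Finset.mul_sum, Finset.sum_div,
    Finset.sum_mul]
  refine Finset.sum_congr rfl fun p hp => ?_
  obtain rfl : p.1 + p.2 = N := mem_antidiagonal.1 hp
  have hci := hc p.1
  have hcij := hc (p.1 + p.2)
  rw [poch_add c] at hcij ⊢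
  have hcj := right_ne_zero_of_mul hcij
  have hfact := Nat.add_choose_mul_factorial_mul_factorial p.1 p.2
  have hfact' : ((p.1 + p.2).choose p.1 : ℂ) * p.1.factorial * p.2.factorial =
      (p.1 + p.2).factorial := by
    rw [Nat.choose_symm_add]
    exact_mod_cast hfact
  have hne (n : ℕ) : (n.factorial : ℂ) ≠ 0 := Nat.cast_ne_zero.2 n.factorial_ne_zero
  rw [pfaffTerm, gaussCoeff, poch_add a, ← hfact']
  have := hne p.1
  have := hne p.2
  have : ((p.1 + p.2).choose p.1 : ℂ) ≠ 0 :=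
    Nat.cast_ne_zero.2 (Nat.choose_pos (Nat.le_add_right _ _)).ne'
  field_simp

theorem hasSum_sum_antidiagonal {F : ℕ × ℕ → ℂ} {S : ℂ} (h : HasSum F S) :
    HasSum (fun N => ∑ p ∈ antidiagonal N, F p) S := by
  refine (Finset.HasAntidiagonal.sigmaAntidiagonalEquivProd.hasSum_iff.2 h).sigma fun N => ?_
  have hfiber := hasSum_fintype (fun p : antidiagonal N => F p)
  rwa [Finset.univ_eq_attach, Finset.sum_attach _ F] at hfiber

theorem pfaff_of_norm_lt_half (a b : ℂ) {c : ℂ} (hc : ∀ n, poch c n ≠ 0) {y : ℂ}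
    (hy : ‖y‖ < 1 / 2) (hz : ‖y / (y - 1)‖ < 1) :
    ₂F₁ a b c y = (1 - y) ^ (-a) * ₂F₁ a (c - b) c (y / (y - 1)) := by
  have hy1 : ‖y‖ < 1 := by linarith
  have hsum := (summable_pfaffTerm a (c - b) c hy).hasSum
  have hrows := hsum.prod_fiberwise (hasSum_pfaffTerm_row a (c - b) c hy1)
  have hdiags := hasSum_sum_antidiagonal hsum
  simp only [sum_antidiagonal_pfaffTerm a (c - b) hc, sub_sub_cancel] at hdiags
  rw [(hasSum_gaussCoeff_mul_pow a b c hy1).unique hdiags,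
    hrows.unique ((hasSum_gaussCoeff_mul_pow a (c - b) c hz).mul_left _)]

theorem norm_div_sub_one_lt_one {z : ℂ} (hz : z.re < 1 / 2) : ‖z / (z - 1)‖ < 1 := by
  have hz1 : z - 1 ≠ 0 := by
    rw [sub_ne_zero]
    rintro rfl
    norm_num at hz
  rw [norm_div, div_lt_one (norm_pos_iff.2 hz1), ← sq_lt_sq₀ (norm_nonneg _) (norm_nonneg _),
    Complex.sq_norm, Complex.sq_norm, Complex.normSq_apply, Complex.normSq_apply,
    Complex.sub_re, Complex.sub_im, Complex.one_re, Complex.one_im]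
  nlinarith

theorem analyticOnNhd_pfaff (a b c : ℂ) :
    AnalyticOnNhd ℂ (fun y : ℂ => (1 - y) ^ (-a) * ₂F₁ a b c (y / (y - 1))) {z | z.re < 1 / 2} := by
  intro z hz
  have hz : z.re < 1 / 2 := hz
  have hslit : 1 - z ∈ Complex.slitPlane :=
    Or.inl (by rw [Complex.sub_re, Complex.one_re]; linarith)
  have hz1 : z - 1 ≠ 0 := by simpa using neg_ne_zero.2 (Complex.slitPlane_ne_zero hslit)
  refine ((analyticAt_const.sub analyticAt_id).cpow analyticAt_const hslit).mul ?_
  exact AnalyticAt.comp (g := ₂F₁ a b c) (f := fun y => y / (y - 1))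
    (analyticOnNhd_ordinaryHypergeometric a b c _ (by simpa using norm_div_sub_one_lt_one hz))
    (analyticAt_id.div (analyticAt_id.sub analyticAt_const) hz1)

theorem pfaff (a b : ℂ) {c : ℂ} (hc : ∀ n, poch c n ≠ 0) {y : ℂ} (hy : ‖y‖ < 1)
    (hre : y.re < 1 / 2) :
    ₂F₁ a b c y = (1 - y) ^ (-a) * ₂F₁ a (c - b) c (y / (y - 1)) := by
  have hconv : Convex ℝ (Metric.ball (0 : ℂ) 1 ∩ {z | z.re < 1 / 2}) :=
    (convex_ball 0 1).inter (convex_halfSpace_re_lt _)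
  refine ((analyticOnNhd_ordinaryHypergeometric a b c).mono
    Set.inter_subset_left).eqOn_of_preconnected_of_eventuallyEq
    ((analyticOnNhd_pfaff a (c - b) c).mono Set.inter_subset_right) hconv.isPreconnected
    (z₀ := 0) (by simp) ?_ ⟨by simpa using hy, hre⟩
  filter_upwards [Metric.ball_mem_nhds (0 : ℂ) one_half_pos] with z hz
  have hz : ‖z‖ < 1 / 2 := by simpa using hz
  exact pfaff_of_norm_lt_half a b hc hz
    (norm_div_sub_one_lt_one ((Complex.re_le_norm z).trans_lt hz))

theorem gaussF_of_re_lt_half (a b : ℂ) {c : ℂ} (hc : ∀ n, poch c n ≠ 0) {y : ℂ}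
    (hre : y.re < 1 / 2) :
    gaussF a b c y = (1 - y) ^ (-a) * ₂F₁ a (c - b) c (y / (y - 1)) := by
  rw [gaussF]
  split_ifs with hy
  · exact pfaff a b hc hy hre
  · rfl

theorem gaussF_one_sub_inv (a b : ℂ) {c : ℂ} (hc : ∀ n, poch c n ≠ 0) {u : ℝ} (h0 : 0 < u)
    (h1 : u < 1) :
    gaussF a b c ((1 - 1 / u : ℝ) : ℂ) = (u : ℂ) ^ a * ₂F₁ a (c - b) c ((1 - u : ℝ) : ℂ) := by
  have hu : (u : ℂ) ≠ 0 := by exact_mod_cast h0.ne'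
  have hre : ((1 - 1 / u : ℝ) : ℂ).re < 1 / 2 := by
    have : 1 < 1 / u := by rwa [lt_div_iff₀ h0, one_mul]
    rw [Complex.ofReal_re]
    linarith
  have hpow : (1 - ((1 - 1 / u : ℝ) : ℂ)) ^ (-a) = (u : ℂ) ^ a := by
    have harg : (u : ℂ).arg ≠ Real.pi := by
      rw [Complex.arg_ofReal_of_nonneg h0.le]
      exact Real.pi_pos.ne
    have hinv : 1 - ((1 - 1 / u : ℝ) : ℂ) = (u : ℂ)⁻¹ := by
      push_cast
      ring
    rw [hinv, Complex.cpow_neg, Complex.inv_cpow _ _ harg, inv_inv]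
  have harg : ((1 - 1 / u : ℝ) : ℂ) / (((1 - 1 / u : ℝ) : ℂ) - 1) = ((1 - u : ℝ) : ℂ) := by
    push_cast
    field_simp
    ring
  rw [gaussF_of_re_lt_half a b hc hre, hpow, harg]

end Pfaff

section GaussSum

/-- A bound for `‖gaussCoeff a b c n‖` on the half-plane `r ≤ c.re`, where `0 < r`. -/
noncomputable def gaussMajorant (a b : ℂ) (r : ℝ) (n : ℕ) : ℝ :=
  ‖poch a n‖ * ‖poch b n‖ / (poch r n * n.factorial)

theorem gaussMajorant_nonneg (a b : ℂ) {r : ℝ} (hr : 0 < r) (n : ℕ) :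
    0 ≤ gaussMajorant a b r n := by
  have := poch_pos hr n
  unfold gaussMajorant
  positivity

theorem norm_gaussCoeff_le (a b : ℂ) {c : ℂ} {r : ℝ} (hr : 0 < r) (hc : r ≤ c.re) (n : ℕ) :
    ‖gaussCoeff a b c n‖ ≤ gaussMajorant a b r n := by
  have hpoch := poch_pos hr n
  rw [gaussCoeff, gaussMajorant, norm_div, norm_mul, norm_mul, Complex.norm_natCast]
  gcongr
  exact poch_le_norm_poch hr.le hc n

theorem gaussCoeff_add_one_right (a b : ℂ) {c : ℂ} (hc : 0 < c.re) (n : ℕ) :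
    gaussCoeff a b (c + 1) n = gaussCoeff a b c n * (c / (c + n)) := by
  have hc₀ : c ≠ 0 := by rintro rfl; simp at hc
  have hpoch := poch_ne_zero hc (n + 1)
  rw [poch_succ] at hpoch
  have hshift : poch (c + 1) n = poch c n * (c + n) / c := by
    rw [← poch_succ, poch_succ', mul_div_cancel_left₀ _ hc₀]
  have h₁ := left_ne_zero_of_mul hpoch
  have h₂ := right_ne_zero_of_mul hpoch
  rw [gaussCoeff, gaussCoeff, hshift]
  field_simp

theorem succ_mul_gaussCoeff_succ (a b : ℂ) {c : ℂ} (hc : 0 < c.re) (n : ℕ) :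
    ((n + 1 : ℕ) : ℂ) * gaussCoeff a b c (n + 1) =
      gaussCoeff a b c n * ((a + n) * (b + n) / (c + n)) := by
  have hpoch := poch_ne_zero hc (n + 1)
  rw [poch_succ] at hpoch
  have h₁ := left_ne_zero_of_mul hpoch
  have h₂ := right_ne_zero_of_mul hpoch
  have h₃ : (n : ℂ) + 1 ≠ 0 := by exact_mod_cast n.succ_ne_zero
  rw [gaussCoeff, gaussCoeff, poch_succ, poch_succ, poch_succ, Nat.factorial_succ]
  push_cast
  field_simp

-- The difference of the two sides is the telescoping sum of `n * gaussCoeff a b c n`.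
theorem tsum_gaussCoeff_contiguous {a b c : ℂ} (hc : 0 < c.re)
    (hs : Summable fun n : ℕ => (n : ℂ) * gaussCoeff a b c n) (hs₀ : Summable (gaussCoeff a b c))
    (hs₁ : Summable (gaussCoeff a b (c + 1))) :
    (c - a - b) * ∑' n, gaussCoeff a b c n =
      (c - a) * (c - b) / c * ∑' n, gaussCoeff a b (c + 1) n := by
  have hc₀ : c ≠ 0 := by rintro rfl; simp at hc
  have htelescope : ∑' n : ℕ, (n : ℂ) * gaussCoeff a b c n =
      ∑' n : ℕ, ((n + 1 : ℕ) : ℂ) * gaussCoeff a b c (n + 1) := by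
    rw [hs.tsum_eq_zero_add]; simp
  rw [← sub_eq_zero, ← tsum_mul_left, ← tsum_mul_left,
    ← (hs₀.mul_left _).tsum_sub (hs₁.mul_left _), ← sub_eq_zero.2 htelescope,
    ← hs.tsum_sub ((summable_nat_add_iff 1).2 hs)]
  refine tsum_congr fun n => ?_
  have hcn : c + (n : ℂ) ≠ 0 := by
    have := poch_ne_zero hc (n + 1)
    rw [poch_succ] at this
    exact right_ne_zero_of_mul this
  rw [gaussCoeff_add_one_right a b hc, succ_mul_gaussCoeff_succ a b hc]
  field_simp
  ring

theorem poch_succ_eq_div_GammaSeq {s : ℂ} (hs : 0 < s.re) {n : ℕ} (hn : n ≠ 0) :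
    poch s (n + 1) = (n : ℂ) ^ s * n.factorial / Complex.GammaSeq s n := by
  have hprod : ∀ m, ∏ j ∈ Finset.range m, (s + j) = poch s m := by
    intro m
    induction m with
    | zero => simp
    | succ m ih => rw [Finset.prod_range_succ, ih, poch_succ]
  have hpoch := poch_ne_zero hs (n + 1)
  have hfact : (n.factorial : ℂ) ≠ 0 := by exact_mod_cast n.factorial_ne_zero
  have hpow : (n : ℂ) ^ s ≠ 0 := Complex.cpow_ne_zero_iff.2 (.inl (by exact_mod_cast hn))
  rw [Complex.GammaSeq, hprod]
  field_simp

theorem GammaSeq_ne_zero {s : ℂ} (hs : 0 < s.re) {n : ℕ} (hn : n ≠ 0) :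
    Complex.GammaSeq s n ≠ 0 := fun h =>
  poch_ne_zero hs (n + 1) (by rw [poch_succ_eq_div_GammaSeq hs hn, h, div_zero])

theorem poch_ratio_eq_GammaSeq_ratio {a b c : ℂ} (hc : 0 < c.re) (hca : 0 < (c - a).re)
    (hcb : 0 < (c - b).re) (hcab : 0 < (c - a - b).re) {n : ℕ} (hn : n ≠ 0) :
    poch (c - a) (n + 1) * poch (c - b) (n + 1) / (poch c (n + 1) * poch (c - a - b) (n + 1)) =
      Complex.GammaSeq c n * Complex.GammaSeq (c - a - b) n /
        (Complex.GammaSeq (c - a) n * Complex.GammaSeq (c - b) n) := by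
  have hn' : (n : ℂ) ≠ 0 := by exact_mod_cast hn
  have hfact : (n.factorial : ℂ) ≠ 0 := by exact_mod_cast n.factorial_ne_zero
  have hpow : ∀ s : ℂ, (n : ℂ) ^ s ≠ 0 := fun s => Complex.cpow_ne_zero_iff.2 (.inl hn')
  have hexp : (n : ℂ) ^ (c - a) * (n : ℂ) ^ (c - b) = (n : ℂ) ^ c * (n : ℂ) ^ (c - a - b) := by
    rw [← Complex.cpow_add _ _ hn', ← Complex.cpow_add _ _ hn']; ring_nf
  have hΓc := GammaSeq_ne_zero hc hn
  have hΓca := GammaSeq_ne_zero hca hn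
  have hΓcb := GammaSeq_ne_zero hcb hn
  have hΓcab := GammaSeq_ne_zero hcab hn
  rw [poch_succ_eq_div_GammaSeq hc hn, poch_succ_eq_div_GammaSeq hca hn,
    poch_succ_eq_div_GammaSeq hcb hn, poch_succ_eq_div_GammaSeq hcab hn,
    div_mul_div_comm, div_mul_div_comm, mul_mul_mul_comm, hexp, mul_mul_mul_comm]
  have hpowc := hpow c
  have hpowcab := hpow (c - a - b)
  -- `field_simp` would otherwise normalize the exponents
  generalize (n : ℂ) ^ (c - a - b) = y at *
  generalize (n : ℂ) ^ c = x at *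
  field_simp

theorem tendsto_poch_ratio {a b c : ℂ} (hc : 0 < c.re) (hca : 0 < (c - a).re)
    (hcb : 0 < (c - b).re) (hcab : 0 < (c - a - b).re) :
    Tendsto (fun n => poch (c - a) n * poch (c - b) n / (poch c n * poch (c - a - b) n)) atTop
      (𝓝 (Complex.Gamma c * Complex.Gamma (c - a - b) /
        (Complex.Gamma (c - a) * Complex.Gamma (c - b)))) := by
  rw [← tendsto_add_atTop_iff_nat 1]
  have hGamma :=
    ((Complex.GammaSeq_tendsto_Gamma c).mul (Complex.GammaSeq_tendsto_Gamma (c - a - b))).div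
    ((Complex.GammaSeq_tendsto_Gamma (c - a)).mul (Complex.GammaSeq_tendsto_Gamma (c - b)))
    (mul_ne_zero (Complex.Gamma_ne_zero_of_re_pos hca) (Complex.Gamma_ne_zero_of_re_pos hcb))
  refine hGamma.congr' ?_
  filter_upwards [eventually_ne_atTop 0] with n hn
    using (poch_ratio_eq_GammaSeq_ratio hc hca hcb hcab hn).symm

theorem norm_gaussCoeff_succ_le (a b : ℂ) {c : ℂ} (hc : 0 < c.re) {J : ℕ} (hJ : J ≠ 0) (n : ℕ) :
    ‖gaussCoeff a b (c + J) (n + 1)‖ ≤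
      ‖poch a (n + 1)‖ * ‖poch b (n + 1)‖ / poch c.re n / J := by
  have hJ' : (0 : ℝ) < J := by exact_mod_cast Nat.pos_of_ne_zero hJ
  have hpoch := poch_pos hc n
  have hle : poch c.re n * J ≤ ‖poch (c + J) (n + 1)‖ := by
    rw [poch_succ', norm_mul, mul_comm]
    refine mul_le_mul ?_ (poch_le_norm_poch hc.le (by simp; linarith) n) hpoch.le (norm_nonneg _)
    refine le_trans ?_ (Complex.re_le_norm _)
    simp [hc.le]
  have hfact : (1 : ℝ) ≤ (n + 1).factorial := by exact_mod_cast Nat.factorial_pos _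
  have hden : poch c.re n * J ≤ ‖poch (c + J) (n + 1) * ((n + 1).factorial : ℂ)‖ := by
    rw [norm_mul, Complex.norm_natCast]
    exact hle.trans (le_mul_of_one_le_right (norm_nonneg _) hfact)
  rw [gaussCoeff, norm_div, norm_mul, div_div]
  gcongr

theorem tendsto_tsum_gaussCoeff_add_nat {a b c : ℂ} (hc : 0 < c.re)
    (hs : Summable (gaussMajorant a b c.re)) :
    Tendsto (fun J : ℕ => ∑' n, gaussCoeff a b (c + J) n) atTop (𝓝 1) := by
  have hone : (1 : ℂ) = ∑' n : ℕ, if n = 0 then 1 else 0 := by simp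
  rw [hone]
  refine tendsto_tsum_of_dominated_convergence hs (fun n => ?_)
    (Eventually.of_forall fun J n => norm_gaussCoeff_le a b hc (by simp) n)
  rcases n with _ | n
  · simp [gaussCoeff]
  · simp only [Nat.add_eq_zero_iff, one_ne_zero, and_false, if_false]
    have hle : ∀ᶠ J : ℕ in atTop, ‖gaussCoeff a b (c + J) (n + 1)‖ ≤
        ‖poch a (n + 1)‖ * ‖poch b (n + 1)‖ / poch c.re n / J := by
      filter_upwards [eventually_ne_atTop 0] with J hJ using norm_gaussCoeff_succ_le a b hc hJ n
    exact squeeze_zero_norm' hle (tendsto_const_nhds.div_atTop tendsto_natCast_atTop_atTop)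

theorem tsum_gaussCoeff_eq_poch_ratio_mul {a b c : ℂ} (hc : 0 < c.re) (hcab : 0 < (c - a - b).re)
    (hs : Summable fun n : ℕ => ((n : ℝ) + 1) * gaussMajorant a b c.re n) (J : ℕ) :
    ∑' n, gaussCoeff a b c n =
      poch (c - a) J * poch (c - b) J / (poch c J * poch (c - a - b) J) *
        ∑' n, gaussCoeff a b (c + J) n := by
  have hle : ∀ j n : ℕ, ‖gaussCoeff a b (c + j) n‖ ≤ gaussMajorant a b c.re n := fun j n =>
    norm_gaussCoeff_le a b hc (by simp) n
  have hsum : ∀ j : ℕ, Summable (gaussCoeff a b (c + j)) := fun j =>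
    Summable.of_norm_bounded hs fun n => (hle j n).trans
      (le_mul_of_one_le_left (gaussMajorant_nonneg a b hc n) (by simp))
  have hsum_mul : ∀ j : ℕ, Summable fun n : ℕ => (n : ℂ) * gaussCoeff a b (c + j) n := fun j =>
    Summable.of_norm_bounded hs fun n => by
      rw [norm_mul, Complex.norm_natCast]
      exact mul_le_mul (by linarith) (hle j n) (norm_nonneg _) (by positivity)
  induction J with
  | zero => simp
  | succ J ih =>
    have hcontiguous := tsum_gaussCoeff_contiguous (hc.trans_le (by simp : c.re ≤ (c + J).re))
      (hsum_mul J) (hsum J) (by have := hsum (J + 1); push_cast at this; rwa [add_assoc])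
    have hpoch := poch_ne_zero hc (J + 1)
    have hpoch' := poch_ne_zero hcab (J + 1)
    rw [poch_succ, mul_ne_zero_iff] at hpoch hpoch'
    obtain ⟨h₁, h₂⟩ := hpoch
    obtain ⟨h₃, h₄⟩ := hpoch'
    have hstep : ∑' n, gaussCoeff a b (c + J) n = (c - a + J) * (c - b + J) /
        ((c + J) * (c - a - b + J)) * ∑' n, gaussCoeff a b (c + (J + 1 : ℕ)) n := by
      push_cast
      rw [← add_assoc]
      generalize ∑' n, gaussCoeff a b (c + J + 1) n = X at *
      field_simp at hcontiguous ⊢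
      linear_combination hcontiguous
    rw [ih, hstep, poch_succ, poch_succ, poch_succ, poch_succ]
    field_simp

theorem hasSum_gaussCoeff_one {a b c : ℂ} (hc : 0 < c.re) (hca : 0 < (c - a).re)
    (hcb : 0 < (c - b).re) (hcab : 0 < (c - a - b).re)
    (hs : Summable fun n : ℕ => ((n : ℝ) + 1) * gaussMajorant a b c.re n) :
    HasSum (gaussCoeff a b c) (Complex.Gamma c * Complex.Gamma (c - a - b) /
      (Complex.Gamma (c - a) * Complex.Gamma (c - b))) := by
  have hmajorant : Summable (gaussMajorant a b c.re) :=
    Summable.of_nonneg_of_le (gaussMajorant_nonneg a b hc)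
      (fun n => le_mul_of_one_le_left (gaussMajorant_nonneg a b hc n) (by simp)) hs
  have hlim := (tendsto_poch_ratio hc hca hcb hcab).mul
    (tendsto_tsum_gaussCoeff_add_nat hc hmajorant)
  rw [mul_one] at hlim
  rw [← tendsto_nhds_unique tendsto_const_nhds
    (hlim.congr fun J => (tsum_gaussCoeff_eq_poch_ratio_mul hc hcab hs J).symm)]
  exact (Summable.of_norm_bounded hmajorant (norm_gaussCoeff_le a b hc le_rfl)).hasSum

end GaussSum

section Beta

open MeasureTheory

/-- The Mellin integral of `g` over `(0, 1)`, i.e. the Mellin transform of `g` cut off at `1`. -/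
noncomputable def unitMellin (g : ℝ → ℂ) (s : ℂ) : ℂ :=
  ∫ u in Set.Ioo (0 : ℝ) 1, (u : ℂ) ^ (s - 1) * g u

/-- Absolute convergence of the integral `unitMellin g s`. -/
def UnitMellinConvergent (g : ℝ → ℂ) (s : ℂ) : Prop :=
  IntegrableOn (fun u : ℝ => (u : ℂ) ^ (s - 1) * g u) (Set.Ioo 0 1)

theorem unitMellinConvergent_one_sub_cpow {s G : ℂ} (hs : 0 < s.re) (hG : 0 < G.re) :
    UnitMellinConvergent (fun u => ((1 - u : ℝ) : ℂ) ^ (G - 1)) s := by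
  have hbeta := Complex.betaIntegral_convergent hs hG
  rw [intervalIntegrable_iff_integrableOn_Ioo_of_le zero_le_one] at hbeta
  simpa [UnitMellinConvergent] using hbeta

theorem unitMellin_one_sub_cpow {s G : ℂ} (hs : 0 < s.re) (hG : 0 < G.re) :
    unitMellin (fun u => ((1 - u : ℝ) : ℂ) ^ (G - 1)) s =
      Complex.Gamma s * Complex.Gamma G / Complex.Gamma (s + G) := by
  have hΓ : Complex.Gamma (s + G) ≠ 0 :=
    Complex.Gamma_ne_zero_of_re_pos (by rw [Complex.add_re]; positivity)
  rw [eq_div_iff hΓ, Complex.Gamma_mul_Gamma_eq_betaIntegral hs hG, mul_comm, unitMellin,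
    Complex.betaIntegral, intervalIntegral.integral_of_le zero_le_one,
    integral_Ioc_eq_integral_Ioo]
  simp

theorem Gamma_ratio_add_nat {s G : ℂ} (hs : 0 < s.re) (hG : 0 < G.re) (N : ℕ) :
    Complex.Gamma s * Complex.Gamma (G + N) / Complex.Gamma (s + (G + N)) =
      Complex.Gamma s * Complex.Gamma G / Complex.Gamma (s + G) * (poch G N / poch (s + G) N) := by
  have hsG : 0 < (s + G).re := by rw [Complex.add_re]; positivity
  have hpoch := poch_ne_zero hsG N
  have hΓ := Complex.Gamma_ne_zero_of_re_pos hsG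
  rw [← add_assoc, Gamma_add_nat_eq_poch_mul hG, Gamma_add_nat_eq_poch_mul hsG]
  field_simp

theorem integral_norm_cpow_mul_one_sub_cpow {s G : ℂ} (hs : 0 < s.re) (hG : 0 < G.re) :
    ((∫ u in Set.Ioo (0 : ℝ) 1, ‖(u : ℂ) ^ (s - 1) * ((1 - u : ℝ) : ℂ) ^ (G - 1)‖ : ℝ) : ℂ) =
      Complex.Gamma s.re * Complex.Gamma G.re / Complex.Gamma (s.re + G.re) := by
  rw [← unitMellin_one_sub_cpow (s := (s.re : ℂ)) (G := (G.re : ℂ)) hs hG, unitMellin,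
    ← integral_complex_ofReal]
  refine setIntegral_congr_fun measurableSet_Ioo fun u hu => ?_
  have hu' : 0 < 1 - u := by linarith [hu.2]
  simp only [norm_mul, Complex.norm_cpow_eq_rpow_re_of_pos hu.1,
    Complex.norm_cpow_eq_rpow_re_of_pos hu', Complex.ofReal_mul, Complex.ofReal_cpow hu.1.le,
    Complex.ofReal_cpow hu'.le]
  simp

theorem integral_norm_cpow_mul_one_sub_cpow_add_nat {s G : ℂ} (hs : 0 < s.re) (hG : 0 < G.re)
    (N : ℕ) :
    ∫ u in Set.Ioo (0 : ℝ) 1, ‖(u : ℂ) ^ (s - 1) * ((1 - u : ℝ) : ℂ) ^ (G + N - 1)‖ =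
      ‖Complex.Gamma s.re * Complex.Gamma G.re / Complex.Gamma (s.re + G.re)‖ *
        (poch G.re N / poch (s + G).re N) := by
  have hGN : 0 < (G + N).re := by rw [Complex.add_re, Complex.natCast_re]; positivity
  have hnorm := congrArg norm (integral_norm_cpow_mul_one_sub_cpow hs hGN)
  rw [Complex.norm_real, Real.norm_of_nonneg (integral_nonneg fun _ => norm_nonneg _),
    Complex.add_re, Complex.natCast_re, Complex.ofReal_add, Complex.ofReal_natCast,
    Gamma_ratio_add_nat (by simpa using hs) (by simpa using hG)] at hnorm
  rw [hnorm, norm_mul, norm_div (poch _ _), norm_poch_ofReal hG.le, ← Complex.ofReal_add,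
    norm_poch_ofReal (by positivity), Complex.add_re]

theorem integrable_and_hasSum_integral {α ι : Type*} [Countable ι] [MeasurableSpace α]
    {ν : Measure α} {F : ι → α → ℂ} {f : α → ℂ} (hF : ∀ i, Integrable (F i) ν)
    (hs : Summable fun i => ∫ a, ‖F i a‖ ∂ν) (hf : ∀ᵐ a ∂ν, HasSum (fun i => F i a) (f a)) :
    Integrable f ν ∧ HasSum (fun i => ∫ a, F i a ∂ν) (∫ a, f a ∂ν) := by
  have hlint : ∑' i, ∫⁻ a, ‖F i a‖ₑ ∂ν ≠ ⊤ := by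
    simp only [← ofReal_integral_norm_eq_lintegral_enorm (hF _)]
    exact hs.tsum_ofReal_ne_top
  have hmeas : AEStronglyMeasurable f ν :=
    aestronglyMeasurable_of_tendsto_ae (u := (atTop : Filter (Finset ι)))
      (f := fun S a => ∑ i ∈ S, F i a)
      (fun S => Finset.aestronglyMeasurable_fun_sum S fun i _ => (hF i).1) hf
  have henorm : ∫⁻ a, ‖f a‖ₑ ∂ν ≤ ∑' i, ∫⁻ a, ‖F i a‖ₑ ∂ν := by
    rw [← lintegral_tsum fun i => (hF i).1.enorm]
    refine lintegral_mono_ae ?_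
    filter_upwards [hf] with a ha
    rw [← ha.tsum_eq]
    exact enorm_tsum_le_tsum_enorm
  refine ⟨⟨hmeas, henorm.trans_lt hlint.lt_top⟩, ?_⟩
  rw [← integral_congr_ae (hf.mono fun a ha => ha.tsum_eq)]
  exact hasSum_integral_of_summable_integral_norm hF hs

end Beta

section Appell

/-- The coefficients of the expansion of `u ^ (-L') F₃(L, L', X, X'; G; 1 - u, 1 - 1 / u)` in
powers of `1 - u`, indexed by the two summation variables `(m, n)`. -/
noncomputable def appellCoeff (L L' X X' G : ℂ) (p : ℕ × ℕ) : ℂ :=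
  poch L p.1 * poch X p.1 * poch L' p.2 * poch (G - X' + p.1) p.2 /
    (p.1.factorial * p.2.factorial * poch G (p.1 + p.2))

/-- A bound for `‖appellCoeff L L' X X' G p‖` when `Z = G - X'` and `S = G.re`. It is also used with
larger `S`, where it is summable. -/
noncomputable def appellMajorant (L L' X Z : ℂ) (S : ℝ) (p : ℕ × ℕ) : ℝ :=
  ‖poch L p.1‖ * ‖poch X p.1‖ * ‖poch L' p.2‖ * ‖poch (Z + p.1) p.2‖ /
    (p.1.factorial * p.2.factorial * poch S (p.1 + p.2))

variable {A : ℕ} {L L' X Z : ℂ} {S : ℝ}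

theorem appellMajorant_nonneg (L L' X Z : ℂ) (hS : 0 < S) (p : ℕ × ℕ) :
    0 ≤ appellMajorant L L' X Z S p := by
  have hpoch := poch_pos hS (p.1 + p.2)
  unfold appellMajorant
  positivity

theorem pow_mul_poch_add_le (hS : 3 * A + 7 ≤ S) (m n : ℕ) :
    (((m : ℝ) + 1) * (n + 1)) ^ (A + 3) * poch ((A : ℝ) + 1) (m + n) ≤
      poch ((A : ℝ) + 1) (2 * (A + 3)) * poch S (m + n) := by
  have hpow : (((m : ℝ) + 1) * (n + 1)) ^ (A + 3) ≤ (((m + n : ℕ) : ℝ) + 1) ^ (2 * (A + 3)) := by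
    rw [pow_mul]
    refine pow_le_pow_left₀ (by positivity) ?_ _
    push_cast
    nlinarith [mul_nonneg (m.cast_nonneg (α := ℝ)) (n.cast_nonneg (α := ℝ))]
  have hpoch : ∀ k, 0 ≤ poch ((A : ℝ) + 1) k := poch_nonneg (by positivity)
  calc (((m : ℝ) + 1) * (n + 1)) ^ (A + 3) * poch ((A : ℝ) + 1) (m + n)
      ≤ (((m + n : ℕ) : ℝ) + 1) ^ (2 * (A + 3)) * poch ((A : ℝ) + 1) (m + n) := by
        gcongr; exact hpoch _
    _ ≤ poch ((A : ℝ) + 1) (2 * (A + 3)) * poch ((A : ℝ) + 1 + (2 * (A + 3) : ℕ)) (m + n) :=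
        pow_mul_poch_le A (2 * (A + 3)) (m + n)
    _ ≤ poch ((A : ℝ) + 1) (2 * (A + 3)) * poch S (m + n) := by
        refine mul_le_mul_of_nonneg_left (poch_mono (by positivity) ?_ _) (hpoch _)
        push_cast
        linarith

theorem norm_poch_mul_le (hL : ‖L‖ ≤ A + 1) (hL' : ‖L'‖ ≤ A + 1) (hX : ‖X‖ ≤ A + 1)
    (hZ : ‖Z‖ ≤ A + 1) (m n : ℕ) :
    ‖poch L m‖ * ‖poch X m‖ * ‖poch L' n‖ * ‖poch (Z + m) n‖ ≤
      poch ((A : ℝ) + 1) (m + n) *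
        ((m.factorial * ((m : ℝ) + 1) ^ A) * (n.factorial * ((n : ℝ) + 1) ^ A)) := by
  have hpoch : ∀ k, 0 ≤ poch ((A : ℝ) + 1) k := poch_nonneg (by positivity)
  have hLZ : ‖poch L m‖ * ‖poch (Z + m) n‖ ≤ poch ((A : ℝ) + 1) (m + n) := by
    rw [poch_add]
    refine mul_le_mul (norm_poch_le hL m) (norm_poch_le ((norm_add_le _ _).trans ?_) n)
      (norm_nonneg _) (hpoch m)
    simpa using hZ
  have hX' := (norm_poch_le hX m).trans (poch_natCast_add_one_le A m)
  have hL'' := (norm_poch_le hL' n).trans (poch_natCast_add_one_le A n)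
  calc ‖poch L m‖ * ‖poch X m‖ * ‖poch L' n‖ * ‖poch (Z + m) n‖
      = ‖poch L m‖ * ‖poch (Z + m) n‖ * (‖poch X m‖ * ‖poch L' n‖) := by ring
    _ ≤ _ := by gcongr; exact hpoch _

theorem succ_mul_succ_mul_appellMajorant_le (hL : ‖L‖ ≤ A + 1) (hL' : ‖L'‖ ≤ A + 1)
    (hX : ‖X‖ ≤ A + 1) (hZ : ‖Z‖ ≤ A + 1) (hS : 3 * A + 7 ≤ S) (m n : ℕ) :
    ((m : ℝ) + 1) * (n + 1) * appellMajorant L L' X Z S (m, n) ≤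
      poch ((A : ℝ) + 1) (2 * (A + 3)) * ((((m : ℝ) + 1) ^ 2)⁻¹ * (((n : ℝ) + 1) ^ 2)⁻¹) := by
  have hS₀ : 0 < S := lt_of_lt_of_le (by positivity) hS
  have hpochS := poch_pos hS₀ (m + n)
  rw [appellMajorant, ← mul_div_assoc, div_le_iff₀ (by positivity)]
  calc ((m : ℝ) + 1) * (n + 1) * (‖poch L m‖ * ‖poch X m‖ * ‖poch L' n‖ * ‖poch (Z + m) n‖)
      ≤ ((m : ℝ) + 1) * (n + 1) * (poch ((A : ℝ) + 1) (m + n) *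
          ((m.factorial * ((m : ℝ) + 1) ^ A) * (n.factorial * ((n : ℝ) + 1) ^ A))) := by
        exact mul_le_mul_of_nonneg_left (norm_poch_mul_le hL hL' hX hZ m n) (by positivity)
    _ = ((((m : ℝ) + 1) * (n + 1)) ^ (A + 3) * poch ((A : ℝ) + 1) (m + n)) *
          ((((m : ℝ) + 1) ^ 2)⁻¹ * (((n : ℝ) + 1) ^ 2)⁻¹ * (m.factorial * n.factorial)) := by
        rw [mul_pow, pow_add, pow_add]; field_simp
    _ ≤ (poch ((A : ℝ) + 1) (2 * (A + 3)) * poch S (m + n)) *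
          ((((m : ℝ) + 1) ^ 2)⁻¹ * (((n : ℝ) + 1) ^ 2)⁻¹ * (m.factorial * n.factorial)) := by
        exact mul_le_mul_of_nonneg_right (pow_mul_poch_add_le hS m n) (by positivity)
    _ = _ := by ring

theorem summable_succ_mul_succ_mul_appellMajorant (hL : ‖L‖ ≤ A + 1) (hL' : ‖L'‖ ≤ A + 1)
    (hX : ‖X‖ ≤ A + 1) (hZ : ‖Z‖ ≤ A + 1) (hS : 3 * A + 7 ≤ S) :
    Summable fun p : ℕ × ℕ => ((p.1 : ℝ) + 1) * (p.2 + 1) * appellMajorant L L' X Z S p := by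
  have hsq : Summable fun n : ℕ => (((n : ℝ) + 1) ^ 2)⁻¹ := by
    simpa using (summable_nat_add_iff 1).2 (Real.summable_nat_pow_inv.2 one_lt_two)
  have hS₀ : 0 < S := lt_of_lt_of_le (by positivity) hS
  exact Summable.of_nonneg_of_le
    (fun p => mul_nonneg (by positivity) (appellMajorant_nonneg L L' X Z hS₀ p))
    (fun p => succ_mul_succ_mul_appellMajorant_le hL hL' hX hZ hS p.1 p.2)
    ((hsq.mul_of_nonneg hsq (fun _ => by positivity) (fun _ => by positivity)).mul_left
      (poch ((A : ℝ) + 1) (2 * (A + 3))))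

theorem norm_appellCoeff_le (L L' X X' : ℂ) {G : ℂ} (hG : 0 < G.re) (hS : 0 < S) (p : ℕ × ℕ) :
    ‖appellCoeff L L' X X' G p‖ ≤ poch S (p.1 + p.2) / poch G.re (p.1 + p.2) *
      (((p.1 : ℝ) + 1) * (p.2 + 1) * appellMajorant L L' X (G - X') S p) := by
  have hpochG := poch_pos hG (p.1 + p.2)
  have hpochS := poch_pos hS (p.1 + p.2)
  have hnorm := poch_le_norm_poch hG.le le_rfl (p.1 + p.2)
  have hone : (1 : ℝ) ≤ ((p.1 : ℝ) + 1) * (p.2 + 1) :=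
    one_le_mul_of_one_le_of_one_le (by simp) (by simp)
  simp only [appellCoeff, appellMajorant, norm_div, norm_mul, Complex.norm_natCast]
  have hnum : 0 ≤ ‖poch L p.1‖ * ‖poch X p.1‖ * ‖poch L' p.2‖ * ‖poch (G - X' + p.1) p.2‖ := by
    positivity
  generalize ‖poch L p.1‖ * ‖poch X p.1‖ * ‖poch L' p.2‖ * ‖poch (G - X' + p.1) p.2‖ = Q at *
  calc Q / (p.1.factorial * p.2.factorial * ‖poch G (p.1 + p.2)‖)
      ≤ Q / (p.1.factorial * p.2.factorial * poch G.re (p.1 + p.2)) := by gcongr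
    _ = poch S (p.1 + p.2) / poch G.re (p.1 + p.2) * (1 *
          (Q / (p.1.factorial * p.2.factorial * poch S (p.1 + p.2)))) := by field_simp
    _ ≤ _ := by gcongr

theorem exists_nat_norm_le (L L' X Z : ℂ) :
    ∃ A : ℕ, ‖L‖ ≤ A + 1 ∧ ‖L'‖ ≤ A + 1 ∧ ‖X‖ ≤ A + 1 ∧ ‖Z‖ ≤ A + 1 := by
  obtain ⟨A, hA⟩ := exists_nat_ge (‖L‖ + ‖L'‖ + ‖X‖ + ‖Z‖)
  have := norm_nonneg L
  have := norm_nonneg L'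
  have := norm_nonneg X
  have := norm_nonneg Z
  exact ⟨A, by linarith, by linarith, by linarith, by linarith⟩

theorem exists_poch_div_poch_mul_pow_le {r : ℝ} (hr : 0 < r) (hS : 0 < S) {v : ℝ} (hv₀ : 0 ≤ v)
    (hv₁ : v < 1) : ∃ C : ℝ, ∀ n, poch S n / poch r n * v ^ n ≤ C := by
  have hsum := summable_norm_gaussCoeff_mul_pow (S : ℂ) 1 (r : ℂ) hv₀ hv₁
  refine ⟨∑' n, ‖gaussCoeff (S : ℂ) 1 r n‖ * v ^ n, fun n => le_trans (le_of_eq ?_)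
    (hsum.le_tsum n fun j _ => by positivity)⟩
  have hfact : (n.factorial : ℝ) ≠ 0 := by exact_mod_cast n.factorial_ne_zero
  rw [gaussCoeff, norm_div, norm_mul, norm_mul, norm_poch_ofReal hS.le, norm_poch_ofReal hr.le,
    poch_one_left, Complex.norm_natCast, mul_div_mul_right _ _ hfact]

theorem summable_appellCoeff_mul_pow (L L' X X' : ℂ) {G : ℂ} (hG : 0 < G.re) {v : ℝ}
    (hv₀ : 0 ≤ v) (hv₁ : v < 1) :
    Summable fun p : ℕ × ℕ => appellCoeff L L' X X' G p * (v : ℂ) ^ (p.1 + p.2) := by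
  obtain ⟨A, hL, hL', hX, hZ⟩ := exists_nat_norm_le L L' X (G - X')
  have hS : (0 : ℝ) < 3 * A + 7 := by positivity
  obtain ⟨C, hC⟩ := exists_poch_div_poch_mul_pow_le hG hS hv₀ hv₁
  refine Summable.of_norm_bounded
    ((summable_succ_mul_succ_mul_appellMajorant hL hL' hX hZ le_rfl).mul_left C) fun p => ?_
  rw [norm_mul, norm_pow, Complex.norm_real, Real.norm_of_nonneg hv₀]
  refine (mul_le_mul_of_nonneg_right (norm_appellCoeff_le L L' X X' hG hS p)
    (by positivity)).trans ?_
  rw [mul_right_comm]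
  exact mul_le_mul_of_nonneg_right (hC _)
    (mul_nonneg (by positivity) (appellMajorant_nonneg L L' X (G - X') hS p))

theorem hasSum_appellCoeff_mul_pow (L L' X X' : ℂ) {G : ℂ} (hG : 0 < G.re) {u : ℝ} (hu₀ : 0 < u)
    (hu₁ : u < 1) :
    HasSum (fun p : ℕ × ℕ => appellCoeff L L' X X' G p * ((1 - u : ℝ) : ℂ) ^ (p.1 + p.2))
      ((u : ℂ) ^ (-L') *
        appellF3 L L' X X' G ((1 - u : ℝ) : ℂ) ((1 - 1 / u : ℝ) : ℂ)) := by
  have hs := summable_appellCoeff_mul_pow L L' X X' hG (v := 1 - u) (by linarith) (by linarith)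
  have hu : (u : ℂ) ≠ 0 := by exact_mod_cast hu₀.ne'
  have hcancel : (u : ℂ) ^ (-L') * (u : ℂ) ^ L' = 1 := by
    rw [← Complex.cpow_add _ _ hu, neg_add_cancel, Complex.cpow_zero]
  convert hs.hasSum using 1
  rw [hs.tsum_prod, appellF3, ← tsum_mul_left]
  refine tsum_congr fun m => ?_
  have hGm : 0 < (G + m).re := by rw [Complex.add_re, Complex.natCast_re]; positivity
  have hv : ‖((1 - u : ℝ) : ℂ)‖ < 1 := by
    rw [Complex.norm_real, Real.norm_of_nonneg (by linarith)]; linarith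
  rw [gaussF_one_sub_inv L' X' (poch_ne_zero hGm) hu₀ hu₁,
    ← (hasSum_gaussCoeff_mul_pow L' (G + m - X') (G + m) hv).tsum_eq,
    mul_left_comm, ← mul_assoc ((u : ℂ) ^ (-L')), hcancel, one_mul, ← tsum_mul_left]
  refine tsum_congr fun n => ?_
  have hpochG := poch_ne_zero hG m
  have hpochGm := poch_ne_zero hGm n
  simp only [gaussCoeff, appellCoeff]
  rw [pow_add, poch_add, show G - X' + m = G + m - X' by ring]
  change poch L m * poch X m / (poch G m * m.factorial) * _ * _ = _
  field_simp

end Appell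

section Kernel

open MeasureTheory

/-- The kernel of the Marichev–Saigo–Maeda integral at `x = 1`. -/
noncomputable def msmKernel (L L' X X' G : ℂ) (u : ℝ) : ℂ :=
  ((1 - u : ℝ) : ℂ) ^ (G - 1) * ((u : ℂ) ^ (-L') *
    appellF3 L L' X X' G ((1 - u : ℝ) : ℂ) ((1 - 1 / u : ℝ) : ℂ))

/-- The terms of the expansion of `msmKernel L L' X X' G` in powers of `1 - u`. -/
noncomputable def msmKernelTerm (L L' X X' G : ℂ) (p : ℕ × ℕ) (u : ℝ) : ℂ :=
  ((1 - u : ℝ) : ℂ) ^ (G + (p.1 + p.2 : ℕ) - 1) * appellCoeff L L' X X' G p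

/-- The numerator of the Mellin transform of `msmKernel L L' X X' G`, up to `Γ(G)`. -/
noncomputable def msmGammaNum (L L' X X' G s : ℂ) : ℂ :=
  Complex.Gamma s * Complex.Gamma (s + X' - L') * Complex.Gamma (s + G - L' - L - X)

/-- The denominator of the Mellin transform of `msmKernel L L' X X' G`. -/
noncomputable def msmGammaDen (L L' X X' G s : ℂ) : ℂ :=
  Complex.Gamma (s + X') * Complex.Gamma (s + G - L' - L) * Complex.Gamma (s + G - L' - X)

variable {A : ℕ} {L L' X X' Z G s c : ℂ}

theorem hasSum_msmKernelTerm (L L' X X' : ℂ) (hG : 0 < G.re) {u : ℝ} (hu₀ : 0 < u) (hu₁ : u < 1) :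
    HasSum (fun p => msmKernelTerm L L' X X' G p u) (msmKernel L L' X X' G u) := by
  have hv : ((1 - u : ℝ) : ℂ) ≠ 0 := by exact_mod_cast (sub_pos.2 hu₁).ne'
  refine ((hasSum_appellCoeff_mul_pow L L' X X' hG hu₀ hu₁).mul_left
    (((1 - u : ℝ) : ℂ) ^ (G - 1))).congr_fun fun p => ?_
  rw [msmKernelTerm, add_sub_right_comm, Complex.cpow_add _ _ hv, Complex.cpow_natCast]
  ring

theorem unitMellinConvergent_msmKernelTerm (L L' X X' : ℂ) (hs : 0 < s.re) (hG : 0 < G.re)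
    (p : ℕ × ℕ) : UnitMellinConvergent (msmKernelTerm L L' X X' G p) s := by
  have hGp : 0 < (G + (p.1 + p.2 : ℕ)).re := by
    rw [Complex.add_re, Complex.natCast_re]; positivity
  simpa only [UnitMellinConvergent, IntegrableOn, msmKernelTerm, mul_assoc] using
    (unitMellinConvergent_one_sub_cpow hs hGp).mul_const (appellCoeff L L' X X' G p)

theorem unitMellin_msmKernelTerm (L L' X X' : ℂ) (hs : 0 < s.re) (hG : 0 < G.re) (p : ℕ × ℕ) :
    unitMellin (msmKernelTerm L L' X X' G p) s =
      Complex.Gamma s * Complex.Gamma G / Complex.Gamma (s + G) *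
        (poch G (p.1 + p.2) / poch (s + G) (p.1 + p.2)) * appellCoeff L L' X X' G p := by
  have hGp : 0 < (G + (p.1 + p.2 : ℕ)).re := by
    rw [Complex.add_re, Complex.natCast_re]; positivity
  rw [← Gamma_ratio_add_nat hs hG, ← unitMellin_one_sub_cpow hs hGp]
  simp only [unitMellin, msmKernelTerm, ← mul_assoc, integral_mul_const]

theorem summable_integral_norm_msmKernelTerm (hL : ‖L‖ ≤ A + 1) (hL' : ‖L'‖ ≤ A + 1)
    (hX : ‖X‖ ≤ A + 1) (hZ : ‖G - X'‖ ≤ A + 1) (hs : 0 < s.re) (hG : 0 < G.re)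
    (hsG : 3 * A + 7 ≤ (s + G).re) :
    Summable fun p => ∫ u in Set.Ioo (0 : ℝ) 1,
      ‖(u : ℂ) ^ (s - 1) * msmKernelTerm L L' X X' G p u‖ := by
  have hsG₀ : 0 < (s + G).re := by rw [Complex.add_re]; positivity
  refine Summable.of_nonneg_of_le (fun p => integral_nonneg fun _ => norm_nonneg _) (fun p => ?_)
    ((summable_succ_mul_succ_mul_appellMajorant hL hL' hX hZ hsG).mul_left
      ‖Complex.Gamma s.re * Complex.Gamma G.re / Complex.Gamma (s.re + G.re)‖)
  simp only [msmKernelTerm, ← mul_assoc, norm_mul _ (appellCoeff L L' X X' G p),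
    integral_mul_const]
  rw [integral_norm_cpow_mul_one_sub_cpow_add_nat hs hG, mul_assoc, mul_assoc, mul_assoc]
  refine mul_le_mul_of_nonneg_left ?_ (norm_nonneg _)
  have hpochG := poch_pos hG (p.1 + p.2)
  have hpochsG := poch_pos hsG₀ (p.1 + p.2)
  refine (mul_le_mul_of_nonneg_left (norm_appellCoeff_le L L' X X' hG hsG₀ p)
    (by positivity)).trans (le_of_eq ?_)
  field_simp

theorem hasSum_gaussCoeff_one_of_le (hL : ‖L‖ ≤ A + 1) (hX : ‖X‖ ≤ A + 1)
    (hc : 3 * A + 7 ≤ c.re) :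
    HasSum (gaussCoeff L X c) (Complex.Gamma c * Complex.Gamma (c - L - X) /
      (Complex.Gamma (c - L) * Complex.Gamma (c - X))) := by
  have hLre := Complex.re_le_norm L
  have hXre := Complex.re_le_norm X
  refine hasSum_gaussCoeff_one (by linarith) (by rw [Complex.sub_re]; linarith)
    (by rw [Complex.sub_re]; linarith) (by rw [Complex.sub_re, Complex.sub_re]; linarith) ?_
  have hs := summable_succ_mul_succ_mul_appellMajorant (L' := L) (Z := L) hL hL hX hL hc
  refine (hs.comp_injective (i := fun m : ℕ => (m, 0)) fun a b hab => by simpa using hab).congr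
    fun m => ?_
  simp [appellMajorant, gaussMajorant, mul_comm]

theorem hasSum_gaussCoeff_one_add_nat (hL' : ‖L'‖ ≤ A + 1) (hZ : ‖Z‖ ≤ A + 1)
    (hc : 3 * A + 7 ≤ c.re) (m : ℕ) :
    HasSum (gaussCoeff L' (Z + m) (c + m)) (Complex.Gamma (c + m) * Complex.Gamma (c - L' - Z) /
      (Complex.Gamma (c - L' + m) * Complex.Gamma (c - Z))) := by
  have hLre := Complex.re_le_norm L'
  have hZre := Complex.re_le_norm Z
  rw [show c - L' - Z = c + m - L' - (Z + m) by ring, show c - L' + m = c + m - L' by ring,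
    show c - Z = c + m - (Z + m) by ring]
  refine hasSum_gaussCoeff_one (by simp; linarith) (by simp; linarith)
    (by simp; linarith) (by simp; linarith) ?_
  have hs := summable_succ_mul_succ_mul_appellMajorant (L := 1) (X := 1) (by simp) hL' (by simp)
    hZ hc
  refine ((hs.prod_factor m).mul_left (poch c.re m / ((m + 1) * m.factorial))).congr fun n => ?_
  have hpoch := poch_pos (r := c.re) (by linarith) m
  simp only [appellMajorant, gaussMajorant, poch_add, poch_one_left, Complex.norm_natCast,
    Complex.add_re, Complex.natCast_re]
  field_simp

theorem tsum_unitMellin_msmKernelTerm (L X : ℂ) (hL' : ‖L'‖ ≤ A + 1) (hZ : ‖G - X'‖ ≤ A + 1)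
    (hG : 0 < G.re) (hs : 0 < s.re) (hsG : 3 * A + 7 ≤ (s + G).re) (hsGL : 0 < (s + G - L').re)
    (m : ℕ) :
    ∑' n, unitMellin (msmKernelTerm L L' X X' G (m, n)) s =
      Complex.Gamma s * Complex.Gamma G * Complex.Gamma (s + X' - L') /
        (Complex.Gamma (s + G - L') * Complex.Gamma (s + X')) *
        gaussCoeff L X (s + G - L') m := by
  have hsG₀ : 0 < (s + G).re := by rw [Complex.add_re]; positivity
  have hsGm : 0 < (s + G + m).re := by
    rw [Complex.add_re (s + G), Complex.natCast_re]; positivity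
  have hpochsG := poch_ne_zero hsG₀ m
  have hpochsGL := poch_ne_zero hsGL m
  have hterm : ∀ n, unitMellin (msmKernelTerm L L' X X' G (m, n)) s =
      Complex.Gamma s * Complex.Gamma G / Complex.Gamma (s + G) * (poch L m * poch X m /
        (m.factorial * poch (s + G) m)) * gaussCoeff L' (G - X' + m) (s + G + m) n := by
    intro n
    have hpochG := poch_ne_zero hG (m + n)
    have hpochsGm := poch_ne_zero hsGm n
    simp only [unitMellin_msmKernelTerm L L' X X' hs hG, appellCoeff, gaussCoeff, poch_add (s + G)]
    field_simp
  have hΓsG := Complex.Gamma_ne_zero_of_re_pos hsG₀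
  have hΓsGL := Complex.Gamma_ne_zero_of_re_pos hsGL
  rw [tsum_congr hterm, tsum_mul_left, (hasSum_gaussCoeff_one_add_nat hL' hZ hsG m).tsum_eq,
    Gamma_add_nat_eq_poch_mul hsG₀, Gamma_add_nat_eq_poch_mul hsGL, gaussCoeff,
    show s + G - L' - (G - X') = s + X' - L' by ring, show s + G - (G - X') = s + X' by ring]
  field_simp

theorem unitMellin_msmKernel_of_le (hL : ‖L‖ ≤ A + 1) (hL' : ‖L'‖ ≤ A + 1) (hX : ‖X‖ ≤ A + 1)
    (hZ : ‖G - X'‖ ≤ A + 1) (hG : 0 < G.re) (hs : 0 < s.re) (hsG : 3 * A + 7 ≤ (s + G).re)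
    (hsGL : 3 * A + 7 ≤ (s + G - L').re) :
    UnitMellinConvergent (msmKernel L L' X X' G) s ∧ unitMellin (msmKernel L L' X X' G) s =
      Complex.Gamma G * msmGammaNum L L' X X' G s / msmGammaDen L L' X X' G s := by
  have hexpand : ∀ᵐ u : ℝ ∂volume.restrict (Set.Ioo (0 : ℝ) 1),
      HasSum (fun p => (u : ℂ) ^ (s - 1) * msmKernelTerm L L' X X' G p u)
        ((u : ℂ) ^ (s - 1) * msmKernel L L' X X' G u) := by
    filter_upwards [ae_restrict_mem measurableSet_Ioo] with u hu
    exact (hasSum_msmKernelTerm L L' X X' hG hu.1 hu.2).mul_left _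
  obtain ⟨hconv, hsum⟩ := integrable_and_hasSum_integral
    (unitMellinConvergent_msmKernelTerm L L' X X' hs hG)
    (summable_integral_norm_msmKernelTerm hL hL' hX hZ hs hG hsG) hexpand
  refine ⟨hconv, ?_⟩
  have hsGL₀ : 0 < (s + G - L').re := lt_of_lt_of_le (by positivity) hsGL
  have hΓsGL := Complex.Gamma_ne_zero_of_re_pos hsGL₀
  calc unitMellin (msmKernel L L' X X' G) s
      = ∑' m, ∑' n, unitMellin (msmKernelTerm L L' X X' G (m, n)) s :=
        hsum.tsum_eq.symm.trans hsum.summable.tsum_prod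
    _ = Complex.Gamma s * Complex.Gamma G * Complex.Gamma (s + X' - L') /
          (Complex.Gamma (s + G - L') * Complex.Gamma (s + X')) *
          ∑' m, gaussCoeff L X (s + G - L') m := by
        rw [tsum_congr (tsum_unitMellin_msmKernelTerm L X hL' hZ hG hs hsG hsGL₀), tsum_mul_left]
    _ = _ := by
        rw [(hasSum_gaussCoeff_one_of_le hL hX hsGL).tsum_eq, msmGammaNum, msmGammaDen]
        field_simp

theorem exists_unitMellin_msmKernel_of_le (L L' X X' : ℂ) (hG : 0 < G.re) :
    ∃ T : ℝ, ∀ s : ℂ, T ≤ s.re → UnitMellinConvergent (msmKernel L L' X X' G) s ∧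
      unitMellin (msmKernel L L' X X' G) s =
        Complex.Gamma G * msmGammaNum L L' X X' G s / msmGammaDen L L' X X' G s := by
  obtain ⟨A, hL, hL', hX, hZ⟩ := exists_nat_norm_le L L' X (G - X')
  have hLre := Complex.re_le_norm L'
  exact ⟨4 * A + 8, fun s hs => unitMellin_msmKernel_of_le hL hL' hX hZ hG (by linarith)
    (by rw [Complex.add_re]; linarith) (by rw [Complex.sub_re, Complex.add_re]; linarith)⟩

end Kernel

section Continuation

open MeasureTheory

variable {g : ℝ → ℂ} {r : ℝ}

theorem UnitMellinConvergent.aestronglyMeasurable {z : ℂ} (hg : UnitMellinConvergent g z) (s : ℂ) :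
    AEStronglyMeasurable (fun u : ℝ => (u : ℂ) ^ (s - 1) * g u)
      (volume.restrict (Set.Ioo 0 1)) := by
  have hpow : Measurable fun u : ℝ => (u : ℂ) ^ (s - z) :=
    Complex.measurable_ofReal.pow_const _
  refine (hpow.aestronglyMeasurable.mul hg.1).congr ?_
  filter_upwards [ae_restrict_mem measurableSet_Ioo] with u hu
  have hu₀ : (u : ℂ) ≠ 0 := by exact_mod_cast hu.1.ne'
  rw [Pi.mul_apply, ← mul_assoc, ← Complex.cpow_add _ _ hu₀, sub_add_sub_cancel]

theorem norm_cpow_sub_one_mul_le (g : ℝ → ℂ) {z s : ℂ} (hs : z.re ≤ s.re) {u : ℝ}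
    (hu : u ∈ Set.Ioo (0 : ℝ) 1) :
    ‖(u : ℂ) ^ (s - 1) * g u‖ ≤ ‖(u : ℂ) ^ (z - 1) * g u‖ := by
  rw [norm_mul, norm_mul, Complex.norm_cpow_eq_rpow_re_of_pos hu.1,
    Complex.norm_cpow_eq_rpow_re_of_pos hu.1]
  refine mul_le_mul_of_nonneg_right ?_ (norm_nonneg _)
  exact Real.rpow_le_rpow_of_exponent_ge hu.1 hu.2.le (by simpa using hs)

theorem UnitMellinConvergent.of_re_le {z s : ℂ} (hg : UnitMellinConvergent g z)
    (hs : z.re ≤ s.re) : UnitMellinConvergent g s := by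
  refine Integrable.mono hg (hg.aestronglyMeasurable s) ?_
  filter_upwards [ae_restrict_mem measurableSet_Ioo] with u hu
  exact norm_cpow_sub_one_mul_le g hs hu

theorem UnitMellinConvergent.integral_norm_le {z s : ℂ} (hg : UnitMellinConvergent g z)
    (hs : z.re ≤ s.re) :
    ∫ u in Set.Ioo (0 : ℝ) 1, ‖(u : ℂ) ^ (s - 1) * g u‖ ≤
      ∫ u in Set.Ioo (0 : ℝ) 1, ‖(u : ℂ) ^ (z - 1) * g u‖ :=
  setIntegral_mono_on (hg.of_re_le hs).norm hg.norm measurableSet_Ioo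
    fun _ hu => norm_cpow_sub_one_mul_le g hs hu

theorem continuousOn_unitMellin (hg : UnitMellinConvergent g r) :
    ContinuousOn (unitMellin g) {s | r ≤ s.re} := by
  refine continuousOn_of_dominated (fun s _ => hg.aestronglyMeasurable s)
    (fun s hs => ?_) hg.norm ?_
  · filter_upwards [ae_restrict_mem measurableSet_Ioo] with u hu
    exact norm_cpow_sub_one_mul_le g (z := r) hs hu
  · filter_upwards [ae_restrict_mem measurableSet_Ioo] with u hu
    have hu₀ : (u : ℂ) ≠ 0 := by exact_mod_cast hu.1.ne'
    exact ContinuousOn.mul (Continuous.const_cpow (by fun_prop) (Or.inl hu₀)).continuousOn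
      continuousOn_const

theorem norm_log_mul_cpow_mul_le (g : ℝ → ℂ) {ε : ℝ} (hε : 0 < ε) {s : ℂ} (hs : r + ε ≤ s.re)
    {u : ℝ} (hu : u ∈ Set.Ioo (0 : ℝ) 1) :
    ‖Complex.log u * ((u : ℂ) ^ (s - 1) * g u)‖ ≤ 1 / ε * ‖(u : ℂ) ^ ((r : ℂ) - 1) * g u‖ := by
  have hu₀ : (u : ℂ) ≠ 0 := by exact_mod_cast hu.1.ne'
  have hsplit : (u : ℂ) ^ (s - 1) = (u : ℂ) ^ (ε : ℂ) * (u : ℂ) ^ (s - ε - 1) := by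
    rw [← Complex.cpow_add _ _ hu₀]; ring_nf
  have hlog := (Real.abs_log_mul_self_rpow_lt u ε hu.1 hu.2.le hε).le
  rw [abs_mul, abs_of_nonneg (Real.rpow_nonneg hu.1.le ε)] at hlog
  rw [hsplit, mul_assoc, ← mul_assoc, norm_mul]
  refine mul_le_mul ?_ (norm_cpow_sub_one_mul_le g (by simp; linarith) hu) (norm_nonneg _)
    (by positivity)
  rwa [norm_mul, Complex.norm_cpow_eq_rpow_re_of_pos hu.1, ← Complex.ofReal_log hu.1.le,
    Complex.norm_real, Complex.ofReal_re, Real.norm_eq_abs]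

theorem differentiableOn_unitMellin (hg : UnitMellinConvergent g r) :
    DifferentiableOn ℂ (unitMellin g) {s | r < s.re} := by
  intro z (hz : r < z.re)
  obtain ⟨ε, hε, hεz⟩ : ∃ ε : ℝ, 0 < ε ∧ r + ε + ε = z.re := ⟨(z.re - r) / 2, by linarith, by ring⟩
  have hball : ∀ s ∈ Metric.ball z ε, r + ε ≤ s.re := by
    intro s hs
    have hre := (Complex.abs_re_le_norm (s - z)).trans (mem_ball_iff_norm.1 hs).le
    rw [Complex.sub_re] at hre
    linarith [(abs_le.1 hre).1]
  refine ((hasDerivAt_integral_of_dominated_loc_of_deriv_le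
    (μ := volume.restrict (Set.Ioo (0 : ℝ) 1))
    (F := fun (s : ℂ) (u : ℝ) => (u : ℂ) ^ (s - 1) * g u)
    (F' := fun (s : ℂ) (u : ℝ) => Complex.log u * ((u : ℂ) ^ (s - 1) * g u))
    (bound := fun u => 1 / ε * ‖(u : ℂ) ^ ((r : ℂ) - 1) * g u‖)
    (Metric.ball_mem_nhds z hε) (Eventually.of_forall hg.aestronglyMeasurable)
    (hg.of_re_le hz.le) ?_ ?_ (hg.norm.const_mul _) ?_).2.differentiableAt).differentiableWithinAt
  · exact (Complex.measurable_log.comp Complex.measurable_ofReal).aestronglyMeasurable.mul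
      (hg.aestronglyMeasurable z)
  · filter_upwards [ae_restrict_mem measurableSet_Ioo] with u hu s hs
    exact norm_log_mul_cpow_mul_le g hε (hball s hs) hu
  · filter_upwards [ae_restrict_mem measurableSet_Ioo] with u hu s _
    have hu₀ : (u : ℂ) ≠ 0 := by exact_mod_cast hu.1.ne'
    refine ((((hasDerivAt_id s).sub_const 1).const_cpow (c := (u : ℂ)) (Or.inl hu₀)).mul_const
      (g u)).congr_deriv ?_
    simp only [id]
    ring

theorem diffContOnCl_unitMellin (hg : UnitMellinConvergent g r) :
    DiffContOnCl ℂ (unitMellin g) {s | r < s.re} :=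
  ⟨differentiableOn_unitMellin hg, by
    rw [Complex.closure_setOfPred_lt_re]; exact continuousOn_unitMellin hg⟩

theorem eqOn_halfPlane_of_eqOn_halfPlane {f₁ f₂ : ℂ → ℂ} {R : ℝ}
    (hf₁ : DiffContOnCl ℂ f₁ {s | r < s.re}) (hf₂ : DiffContOnCl ℂ f₂ {s | r < s.re})
    (heq : Set.EqOn f₁ f₂ {s | R < s.re}) : Set.EqOn f₁ f₂ {s | r ≤ s.re} := by
  have hopen : ∀ ρ : ℝ, IsOpen {s : ℂ | ρ < s.re} := fun ρ =>
    isOpen_lt continuous_const Complex.continuous_re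
  have hlocal : f₁ =ᶠ[𝓝 ((max r R + 1 : ℝ) : ℂ)] f₂ :=
    heq.eventuallyEq_of_mem ((hopen R).mem_nhds
      (show R < max r R + 1 from (le_max_right r R).trans_lt (lt_add_one _)))
  have hinterior : Set.EqOn f₁ f₂ {s | r < s.re} :=
    (hf₁.differentiableOn.analyticOnNhd (hopen r)).eqOn_of_preconnected_of_eventuallyEq
      (hf₂.differentiableOn.analyticOnNhd (hopen r)) (convex_halfSpace_re_gt r).isPreconnected
      (show r < max r R + 1 from (le_max_left r R).trans_lt (lt_add_one _)) hlocal
  rw [← Complex.closure_setOfPred_lt_re]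
  exact hinterior.of_subset_closure hf₁.continuousOn hf₂.continuousOn subset_closure subset_rfl

theorem differentiable_inv_Gamma_comp {f : ℂ → ℂ} (hf : Differentiable ℂ f) :
    Differentiable ℂ fun s => (Complex.Gamma (f s))⁻¹ :=
  Complex.differentiable_one_div_Gamma.comp hf

theorem differentiable_inv_msmGammaNum (L L' X X' G : ℂ) :
    Differentiable ℂ fun s => (msmGammaNum L L' X X' G s)⁻¹ := by
  simp only [msmGammaNum, mul_inv]
  exact ((differentiable_inv_Gamma_comp (by fun_prop)).mul
    (differentiable_inv_Gamma_comp (by fun_prop))).mul (differentiable_inv_Gamma_comp (by fun_prop))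

theorem differentiable_inv_msmGammaDen (L L' X X' G : ℂ) :
    Differentiable ℂ fun s => (msmGammaDen L L' X X' G s)⁻¹ := by
  simp only [msmGammaDen, mul_inv]
  exact ((differentiable_inv_Gamma_comp (by fun_prop)).mul
    (differentiable_inv_Gamma_comp (by fun_prop))).mul (differentiable_inv_Gamma_comp (by fun_prop))

theorem exists_msmGammaNum_ne_zero (L L' X X' G : ℂ) :
    ∃ R : ℝ, ∀ s : ℂ, R < s.re → msmGammaNum L L' X X' G s ≠ 0 := by
  refine ⟨max 0 (max (L'.re - X'.re) (L'.re + L.re + X.re - G.re)), fun s hs => ?_⟩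
  simp only [max_lt_iff] at hs
  refine mul_ne_zero (mul_ne_zero ?_ ?_) ?_ <;> refine Complex.Gamma_ne_zero_of_re_pos ?_
  · exact hs.1
  · simp only [Complex.add_re, Complex.sub_re]; linarith
  · simp only [Complex.add_re, Complex.sub_re]; linarith

theorem unitMellin_msmKernel_mul_inv (L L' X X' : ℂ) {G : ℂ} (hG : 0 < G.re)
    (hr : UnitMellinConvergent (msmKernel L L' X X' G) r) {s : ℂ} (hs : r ≤ s.re) :
    unitMellin (msmKernel L L' X X' G) s * (msmGammaNum L L' X X' G s)⁻¹ =
      Complex.Gamma G * (msmGammaDen L L' X X' G s)⁻¹ := by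
  obtain ⟨T, hT⟩ := exists_unitMellin_msmKernel_of_le L L' X X' hG
  obtain ⟨R, hR⟩ := exists_msmGammaNum_ne_zero L L' X X' G
  refine eqOn_halfPlane_of_eqOn_halfPlane (R := max T R)
    ((diffContOnCl_unitMellin hr).smul (differentiable_inv_msmGammaNum L L' X X' G).diffContOnCl)
    ((differentiable_inv_msmGammaDen L L' X X' G).const_mul _).diffContOnCl (fun s hs => ?_) hs
  have hs' : T < s.re ∧ R < s.re := max_lt_iff.1 hs
  have hnum := hR s hs'.2
  simp only [smul_eq_mul, (hT s hs'.1.le).2]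
  field_simp

end Continuation

section Growth

theorem exists_norm_inv_Gamma_le_of_re_mem_Icc (m M t : ℝ) :
    ∃ C : ℝ, ∀ s : ℂ, s.re ∈ Set.Icc m M → s.im = t → ‖(Complex.Gamma s)⁻¹‖ ≤ C := by
  have hK : IsCompact (Set.Icc m M ×ℂ {t}) := isCompact_Icc.reProdIm isCompact_singleton
  obtain ⟨C, hC⟩ := hK.exists_bound_of_continuousOn
    Complex.differentiable_one_div_Gamma.continuous.continuousOn
  exact ⟨C, fun s hre him => hC s (Complex.mem_reProdIm.2 ⟨hre, him⟩)⟩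

theorem norm_inv_Gamma_mul_factorial_le {s : ℂ} {j : ℕ} (hj : j = 0 ∨ j + 1 ≤ s.re) :
    ‖(Complex.Gamma s)⁻¹‖ * j.factorial ≤ ‖(Complex.Gamma (s - j))⁻¹‖ := by
  have hfact : (j.factorial : ℝ) ≤ ‖poch (s - j) j‖ := by
    rcases hj with rfl | hj
    · simp
    · rw [← poch_one_left]
      exact poch_le_norm_poch zero_le_one (by simp; linarith) j
  rw [Gamma_inv_eq_poch_mul (s - j) j, sub_add_cancel, norm_mul, mul_comm]
  exact mul_le_mul_of_nonneg_right hfact (norm_nonneg _)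

theorem exists_norm_inv_Gamma_mul_factorial_floor_le (m t : ℝ) :
    ∃ C : ℝ, ∀ s : ℂ, m ≤ s.re → s.im = t →
      ‖(Complex.Gamma s)⁻¹‖ * (⌊s.re⌋₊ - 1).factorial ≤ C := by
  obtain ⟨C, hC⟩ := exists_norm_inv_Gamma_le_of_re_mem_Icc (min m 1) 2 t
  refine ⟨C, fun s hs ht => ?_⟩
  have hlt := Nat.lt_floor_add_one s.re
  rcases le_or_gt ⌊s.re⌋₊ 1 with hle | hgt
  · have hle' : (⌊s.re⌋₊ : ℝ) ≤ 1 := by exact_mod_cast hle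
    rw [Nat.sub_eq_zero_of_le hle, Nat.factorial_zero, Nat.cast_one, mul_one]
    exact hC s ⟨(min_le_left _ _).trans hs, by linarith⟩ ht
  · obtain ⟨j, hj⟩ : ∃ j, ⌊s.re⌋₊ = j + 1 := ⟨⌊s.re⌋₊ - 1, by lia⟩
    have hfloor : (⌊s.re⌋₊ : ℝ) ≤ s.re := Nat.floor_le (Nat.pos_of_floor_pos (by lia)).le
    rw [hj, Nat.cast_succ] at hfloor hlt
    rw [hj, Nat.add_sub_cancel]
    refine (norm_inv_Gamma_mul_factorial_le (Or.inr hfloor)).trans (hC _ ⟨?_, ?_⟩ (by simp [ht]))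
    · exact (min_le_right _ _).trans (by simp; linarith)
    · simp; linarith

theorem exists_le_mul_floor_sub_one_add {α : ℝ} (hα : 0 < α) (x : ℝ) :
    ∃ P M : ℕ, ∀ k : ℕ, k ≤ P * (⌊α * k + x⌋₊ - 1 + M) := by
  obtain ⟨M, hM⟩ := exists_nat_ge (2 - x)
  obtain ⟨P, hP⟩ := exists_nat_ge (1 / α)
  refine ⟨P, M, fun k => ?_⟩
  have hlt := Nat.lt_floor_add_one (α * k + x)
  have hfloor : (⌊α * k + x⌋₊ : ℝ) ≤ (⌊α * k + x⌋₊ - 1 : ℕ) + 1 := by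
    exact_mod_cast (by lia : ⌊α * k + x⌋₊ ≤ ⌊α * k + x⌋₊ - 1 + 1)
  have hcast : (k : ℝ) ≤ P * ((⌊α * k + x⌋₊ - 1 : ℕ) + M) := by
    calc (k : ℝ) = 1 / α * (α * k) := by field_simp
      _ ≤ P * ((⌊α * k + x⌋₊ - 1 : ℕ) + M) := by gcongr; linarith
  exact_mod_cast hcast

theorem exists_norm_inv_Gamma_mul_pow_le {α : ℝ} (hα : 0 < α) (μ : ℂ) {R : ℝ} (hR : 1 ≤ R) :
    ∃ C : ℝ, ∀ k : ℕ, ‖(Complex.Gamma (α * k + μ))⁻¹‖ * R ^ k ≤ C := by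
  obtain ⟨C, hC⟩ := exists_norm_inv_Gamma_mul_factorial_floor_le μ.re μ.im
  obtain ⟨P, M, hPM⟩ := exists_le_mul_floor_sub_one_add hα μ.re
  refine ⟨C * Real.exp (R ^ P) * (R ^ P) ^ M, fun k => ?_⟩
  have hre : (α * k + μ : ℂ).re = α * k + μ.re := by simp
  have hGamma := hC (α * k + μ) (by rw [hre]; simpa using mul_nonneg hα.le k.cast_nonneg) (by simp)
  rw [hre] at hGamma
  set j := ⌊α * k + μ.re⌋₊ - 1
  have hpow : R ^ k ≤ (R ^ P) ^ j * (R ^ P) ^ M := by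
    rw [← pow_add, ← pow_mul]
    exact pow_le_pow_right₀ hR (hPM k)
  have hexp := Real.pow_div_factorial_le_exp (R ^ P) (by positivity) j
  rw [div_le_iff₀ (by positivity)] at hexp
  calc _ ≤ ‖(Complex.Gamma (α * k + μ))⁻¹‖ * ((R ^ P) ^ j * (R ^ P) ^ M) := by gcongr
    _ ≤ ‖(Complex.Gamma (α * k + μ))⁻¹‖ * (Real.exp (R ^ P) * j.factorial * (R ^ P) ^ M) := by
      gcongr
    _ = (‖(Complex.Gamma (α * k + μ))⁻¹‖ * j.factorial) * (Real.exp (R ^ P) * (R ^ P) ^ M) := by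
      ring
    _ ≤ C * (Real.exp (R ^ P) * (R ^ P) ^ M) := by gcongr
    _ = _ := by ring

theorem exists_norm_inv_Gamma_nat_mul_le (a : ℕ) (β : ℂ) :
    ∃ C : ℝ, ∀ k : ℕ, ‖(Complex.Gamma (a * k + β))⁻¹‖ ≤ C := by
  rcases Nat.eq_zero_or_pos a with rfl | ha
  · exact ⟨‖(Complex.Gamma β)⁻¹‖, fun k => by simp⟩
  · obtain ⟨C, hC⟩ := exists_norm_inv_Gamma_mul_pow_le (α := a) (by exact_mod_cast ha) β le_rfl
    exact ⟨C, fun k => by simpa using hC k⟩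

/-- `e` is the sequence of Taylor coefficients at `0` of an entire function. -/
def EntireCoeff (e : ℕ → ℂ) : Prop :=
  ∀ R : ℝ, 0 ≤ R → Summable fun k => ‖e k‖ * R ^ k

theorem EntireCoeff.of_norm_le {e e' : ℕ → ℂ} (he : EntireCoeff e) {B Q : ℝ} (hQ : 0 ≤ Q)
    (hle : ∀ k, ‖e' k‖ ≤ B * Q ^ k * ‖e k‖) : EntireCoeff e' := by
  intro R hR
  refine Summable.of_nonneg_of_le (fun k => by positivity) (fun k => ?_)
    ((he (Q * R) (by positivity)).mul_left B)
  calc ‖e' k‖ * R ^ k ≤ (B * Q ^ k * ‖e k‖) * R ^ k := by gcongr; exact hle k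
    _ = B * (‖e k‖ * (Q * R) ^ k) := by rw [mul_pow]; ring

theorem EntireCoeff.of_norm_mul_pow_le {e : ℕ → ℂ}
    (he : ∀ R : ℝ, 1 ≤ R → ∃ C : ℝ, ∀ k, ‖e k‖ * R ^ k ≤ C) : EntireCoeff e := by
  intro R hR
  obtain ⟨C, hC⟩ := he (2 * R + 1) (by linarith)
  refine Summable.of_nonneg_of_le (fun k => by positivity) (fun k => ?_)
    (summable_geometric_two.mul_left C)
  have htwo : (2 * R) ^ k ≤ (2 * R + 1) ^ k := by gcongr; linarith
  calc ‖e k‖ * R ^ k = ‖e k‖ * (2 * R) ^ k * (1 / 2) ^ k := by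
        rw [mul_assoc, ← mul_pow]; ring_nf
    _ ≤ ‖e k‖ * (2 * R + 1) ^ k * (1 / 2) ^ k := by gcongr
    _ ≤ C * (1 / 2) ^ k := by gcongr; exact hC k

theorem EntireCoeff.summable {e : ℕ → ℂ} (he : EntireCoeff e) (z : ℂ) :
    Summable fun k => e k * z ^ k :=
  Summable.of_norm (by simpa using he ‖z‖ (norm_nonneg z))

theorem entireCoeff_inv_Gamma {α : ℝ} (hα : 0 < α) (μ : ℂ) :
    EntireCoeff fun k => (Complex.Gamma (α * k + μ))⁻¹ :=
  .of_norm_mul_pow_le fun _ hR => exists_norm_inv_Gamma_mul_pow_le hα μ hR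

end Growth

section Derivative

/-- The function `t ↦ t ^ ν * ∑' k, e k * t ^ (2 * k)` on the positive half-line: a power times an
even entire function, the shape of the Struve function and of its fractional integrals. -/
noncomputable def cpowSeries (ν : ℂ) (e : ℕ → ℂ) (t : ℝ) : ℂ :=
  (t : ℂ) ^ ν * ∑' k, e k * ((t : ℂ) ^ 2) ^ k

variable {e : ℕ → ℂ}

theorem EntireCoeff.hasDerivAt_tsum (he : EntireCoeff e) (w : ℂ) :
    HasDerivAt (fun w => ∑' k, e k * w ^ k) (∑' k : ℕ, e k * (k * w ^ (k - 1))) w := by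
  have hR : 1 ≤ ‖w‖ + 1 := le_add_of_nonneg_left (norm_nonneg w)
  refine hasDerivAt_tsum_of_isPreconnected (he (2 * (‖w‖ + 1)) (by positivity))
    (Metric.isOpen_ball (x := (0 : ℂ)) (ε := ‖w‖ + 1)) (convex_ball _ _).isPreconnected
    (fun k z _ => (hasDerivAt_pow k z).const_mul (e k)) (fun k z hz => ?_)
    (Metric.mem_ball_self (by positivity)) (he.summable 0) (by simp)
  have hk : (k : ℝ) ≤ 2 ^ k := by exact_mod_cast k.lt_two_pow_self.le
  have hpow : ‖z‖ ^ (k - 1) ≤ (‖w‖ + 1) ^ k :=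
    (pow_le_pow_left₀ (norm_nonneg z) (mem_ball_zero_iff.1 hz).le _).trans
      (pow_le_pow_right₀ hR (Nat.sub_le _ _))
  rw [norm_mul, norm_mul, Complex.norm_natCast, norm_pow, mul_pow]
  gcongr

theorem EntireCoeff.natCast_mul (he : EntireCoeff e) : EntireCoeff fun k => k * e k := by
  refine he.of_norm_le (B := 1) (Q := 2) (by norm_num) fun k => ?_
  have hk : (k : ℝ) ≤ 2 ^ k := by exact_mod_cast k.lt_two_pow_self.le
  rw [norm_mul, Complex.norm_natCast, one_mul]
  gcongr

theorem EntireCoeff.const_mul (he : EntireCoeff e) (z : ℂ) : EntireCoeff fun k => z * e k :=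
  he.of_norm_le (B := ‖z‖) (Q := 1) zero_le_one fun k => by simp

theorem EntireCoeff.add {e' : ℕ → ℂ} (he : EntireCoeff e) (he' : EntireCoeff e') :
    EntireCoeff fun k => e k + e' k := by
  intro R hR
  refine Summable.of_nonneg_of_le (fun k => by positivity) (fun k => ?_) ((he R hR).add (he' R hR))
  rw [← add_mul]
  gcongr
  exact norm_add_le _ _

theorem EntireCoeff.add_two_mul_mul (he : EntireCoeff e) (ν : ℂ) :
    EntireCoeff fun k => (ν + 2 * k) * e k := by
  simpa only [add_mul, mul_assoc] using (he.const_mul ν).add (he.natCast_mul.const_mul 2)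

theorem mul_tsum_natCast_mul_pow_sub_one (e : ℕ → ℂ) (w : ℂ) :
    w * ∑' k : ℕ, e k * (k * w ^ (k - 1)) = ∑' k : ℕ, k * e k * w ^ k := by
  rw [← tsum_mul_left]
  refine tsum_congr fun k => ?_
  rcases k with _ | k
  · simp
  · rw [Nat.add_sub_cancel, pow_succ]
    ring

theorem EntireCoeff.tsum_add_two_mul_mul (he : EntireCoeff e) (ν w : ℂ) :
    ∑' k : ℕ, (ν + 2 * k) * e k * w ^ k =
      ν * ∑' k, e k * w ^ k + 2 * ∑' k : ℕ, k * e k * w ^ k := by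
  rw [← tsum_mul_left, ← tsum_mul_left,
    ← ((he.summable w).mul_left ν).tsum_add ((he.natCast_mul.summable w).mul_left 2)]
  exact tsum_congr fun k => by ring

theorem EntireCoeff.hasDerivAt_cpowSeries (he : EntireCoeff e) (ν : ℂ) {t : ℝ} (ht : 0 < t) :
    HasDerivAt (cpowSeries ν e) (cpowSeries (ν - 1) (fun k => (ν + 2 * k) * e k) t) t := by
  have ht₀ : (t : ℂ) ≠ 0 := by exact_mod_cast ht.ne'
  have hderiv : HasDerivAt (fun z : ℂ => z ^ ν * ∑' k, e k * (z ^ 2) ^ k)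
      (ν * (t : ℂ) ^ (ν - 1) * 1 * ∑' k, e k * ((t : ℂ) ^ 2) ^ k + (t : ℂ) ^ ν *
        ((∑' k : ℕ, e k * (k * ((t : ℂ) ^ 2) ^ (k - 1))) * ((2 : ℕ) * (t : ℂ) ^ (2 - 1)))) t := by
    refine HasDerivAt.mul ?_ ?_
    · exact (hasDerivAt_id (t : ℂ)).cpow_const (Or.inl (by simpa using ht))
    · exact (he.hasDerivAt_tsum ((t : ℂ) ^ 2)).comp (t : ℂ) (hasDerivAt_pow 2 (t : ℂ))
  refine hderiv.comp_ofReal.congr_deriv ?_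
  have hpow : (t : ℂ) ^ ν = (t : ℂ) ^ (ν - 1) * t := by
    rw [Complex.cpow_sub _ _ ht₀, Complex.cpow_one, div_mul_cancel₀ _ ht₀]
  rw [cpowSeries, he.tsum_add_two_mul_mul, ← mul_tsum_natCast_mul_pow_sub_one, hpow]
  push_cast
  ring

theorem EntireCoeff.poch_mul (he : EntireCoeff e) (τ : ℂ) (n : ℕ) :
    EntireCoeff fun k => poch (τ + 2 * k) n * e k := by
  induction n with
  | zero => simpa using he
  | succ n ih =>
    convert ih.add_two_mul_mul (τ + n) using 2 with k
    rw [poch_succ]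
    ring

theorem EntireCoeff.iteratedDeriv_cpowSeries (he : EntireCoeff e) (ν : ℂ) (n : ℕ) {t : ℝ}
    (ht : 0 < t) :
    iteratedDeriv n (cpowSeries ν e) t =
      cpowSeries (ν - n) (fun k => poch (ν - n + 1 + 2 * k) n * e k) t := by
  induction n generalizing t with
  | zero => simp
  | succ n ih =>
    have hlocal : iteratedDeriv n (cpowSeries ν e) =ᶠ[𝓝 t]
        cpowSeries (ν - n) (fun k => poch (ν - n + 1 + 2 * k) n * e k) := by
      filter_upwards [lt_mem_nhds ht] with z hz using ih hz
    rw [iteratedDeriv_succ, hlocal.deriv_eq,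
      ((he.poch_mul (ν - n + 1) n).hasDerivAt_cpowSeries (ν - n) ht).deriv, Nat.cast_succ,
      sub_sub]
    congr 1
    ext k
    rw [poch_succ', show ν - (n + 1) + 1 + 2 * (k : ℂ) = ν - n + 2 * k by ring,
      show ν - n + 2 * (k : ℂ) + 1 = ν - n + 1 + 2 * k by ring, mul_assoc]

theorem EntireCoeff.contDiffAt_cpowSeries (he : EntireCoeff e) (ν : ℂ) (n : ℕ) {t : ℝ}
    (ht : 0 < t) : ContDiffAt ℝ n (cpowSeries ν e) t := by
  have hentire : Differentiable ℂ fun w => ∑' k, e k * w ^ k := fun w =>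
    (he.hasDerivAt_tsum w).differentiableAt
  have hcomplex : ContDiffAt ℂ n (fun z : ℂ => z ^ ν * ∑' k, e k * (z ^ 2) ^ k) t :=
    (analyticAt_id.cpow analyticAt_const (by simpa using ht)).contDiffAt.mul
      (hentire.comp (differentiable_pow 2)).contDiff.contDiffAt
  exact (hcomplex.restrict_scalars ℝ).comp t Complex.ofRealCLM.contDiff.contDiffAt

end Derivative

section Scaling

open MeasureTheory

variable {f f' : ℝ → ℂ}

theorem msmIntegrand_mul (L L' X X' G : ℂ) (f : ℝ → ℂ) {y u : ℝ} (hy : 0 < y)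
    (hu : u ∈ Set.Ioo (0 : ℝ) 1) :
    msmIntegrand L L' X X' G f y (y * u) =
      (y : ℂ) ^ (G - L' - 1) * (msmKernel L L' X X' G u * f (y * u)) := by
  have hy₀ : (y : ℂ) ≠ 0 := by exact_mod_cast hy.ne'
  have hsub : ((y - y * u : ℝ) : ℂ) = (y : ℂ) * ((1 - u : ℝ) : ℂ) := by push_cast; ring
  have hinv : 1 - y / (y * u) = 1 - 1 / u := by
    rw [mul_comm, div_mul_cancel_right₀ hy.ne', one_div]
  have hpow : (y : ℂ) ^ (G - L' - 1) = (y : ℂ) ^ (G - 1) * (y : ℂ) ^ (-L') := by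
    rw [← Complex.cpow_add _ _ hy₀]; ring_nf
  rw [msmIntegrand, msmKernel, hsub, mul_div_cancel_left₀ _ hy.ne', hinv, hpow,
    Complex.ofReal_mul y u, Complex.mul_cpow_ofReal_nonneg hy.le (sub_pos.2 hu.2).le,
    Complex.mul_cpow_ofReal_nonneg hy.le hu.1.le]
  ring

theorem MSMIntegralExists.integrableOn_msmKernel_mul {L L' X X' G : ℂ} {y : ℝ}
    (hf : MSMIntegralExists L L' X X' G f y) (hy : 0 < y) :
    IntegrableOn (fun u : ℝ => msmKernel L L' X X' G u * f (y * u)) (Set.Ioo 0 1) := by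
  have hpow : (y : ℂ) ^ (G - L' - 1) ≠ 0 :=
    Complex.cpow_ne_zero_iff.2 (Or.inl (by exact_mod_cast hy.ne'))
  have hscaled :=
    ((intervalIntegrable_iff_integrableOn_Ioo_of_le hy.le).2 hf).comp_mul_left (c := y)
  rw [zero_div, div_self hy.ne',
    intervalIntegrable_iff_integrableOn_Ioo_of_le zero_le_one] at hscaled
  refine IntegrableOn.congr_fun (hscaled.const_mul ((y : ℂ) ^ (G - L' - 1))⁻¹) (fun u hu => ?_)
    measurableSet_Ioo
  simp only [msmIntegrand_mul L L' X X' G f hy hu, inv_mul_cancel_left₀ hpow]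

theorem msmIntegral_eq_integral_msmKernel_mul (L L' X X' G : ℂ) (f : ℝ → ℂ) {y : ℝ} (hy : 0 < y) :
    msmIntegral L L' X X' G f y = (y : ℂ) ^ (G - L - L') / Complex.Gamma G *
      ∫ u in Set.Ioo (0 : ℝ) 1, msmKernel L L' X X' G u * f (y * u) := by
  have hy₀ : (y : ℂ) ≠ 0 := by exact_mod_cast hy.ne'
  have hscaled := intervalIntegral.smul_integral_comp_mul_left (a := 0) (b := 1)
    (msmIntegrand L L' X X' G f y) y
  rw [mul_zero, mul_one, intervalIntegral.integral_of_le zero_le_one,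
    intervalIntegral.integral_of_le hy.le, integral_Ioc_eq_integral_Ioo,
    integral_Ioc_eq_integral_Ioo] at hscaled
  have hpow : (y : ℂ) ^ (G - L - L') = (y : ℂ) ^ (-L) * (y * (y : ℂ) ^ (G - L' - 1)) := by
    nth_rewrite 3 [← Complex.cpow_one (y : ℂ)]
    rw [← Complex.cpow_add _ _ hy₀, ← Complex.cpow_add _ _ hy₀]
    ring_nf
  rw [msmIntegral, ← hscaled, setIntegral_congr_fun measurableSet_Ioo
    (fun u hu => msmIntegrand_mul L L' X X' G f hy hu), integral_const_mul, Complex.real_smul,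
    hpow]
  ring

theorem eqOn_msmIntegrand (L L' X X' G : ℂ) (hf : Set.EqOn f f' (Set.Ioi 0)) (y : ℝ) :
    Set.EqOn (msmIntegrand L L' X X' G f y) (msmIntegrand L L' X X' G f' y) (Set.Ioo 0 y) :=
  fun t ht => by rw [msmIntegrand, msmIntegrand, hf ht.1]

theorem msmIntegral_congr (L L' X X' G : ℂ) (hf : Set.EqOn f f' (Set.Ioi 0)) :
    msmIntegral L L' X X' G f = msmIntegral L L' X X' G f' := by
  ext y
  rw [msmIntegral, msmIntegral,
    setIntegral_congr_fun measurableSet_Ioo (eqOn_msmIntegrand L L' X X' G hf y)]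

theorem MSMIntegralExists.congr {L L' X X' G : ℂ} {y : ℝ} (hy : MSMIntegralExists L L' X X' G f y)
    (hf : Set.EqOn f f' (Set.Ioi 0)) : MSMIntegralExists L L' X X' G f' y :=
  IntegrableOn.congr_fun hy (eqOn_msmIntegrand L L' X X' G hf y) measurableSet_Ioo

end Scaling

section LeadingTerm

open MeasureTheory Asymptotics

variable {g h : ℝ → ℂ} {d : ℕ → ℂ} {z : ℂ}

theorem cpow_add_two_mul_natCast (ν : ℂ) (k : ℕ) (hz : z ≠ 0) :
    z ^ (ν + 2 * k) = z ^ ν * (z ^ 2) ^ k := by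
  rw [Complex.cpow_add _ _ hz, ← pow_mul, ← Complex.cpow_natCast, Nat.cast_mul, Nat.cast_ofNat]

theorem EntireCoeff.comp_add_nat (hd : EntireCoeff d) (m : ℕ) : EntireCoeff fun k => d (k + m) := by
  intro R hR
  refine Summable.of_nonneg_of_le (fun k => by positivity) (fun k => ?_)
    ((summable_nat_add_iff m).2 (hd (R + 1) (by positivity)))
  refine mul_le_mul_of_nonneg_left ?_ (norm_nonneg _)
  exact (pow_le_pow_left₀ hR (by linarith) k).trans
    (pow_le_pow_right₀ (by linarith) (Nat.le_add_right _ _))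

theorem EntireCoeff.tsum_eq_pow_mul_tsum (hd : EntireCoeff d) {m : ℕ} (hm : ∀ k < m, d k = 0)
    (w : ℂ) : ∑' k, d k * w ^ k = w ^ m * ∑' k, d (k + m) * w ^ k := by
  rw [← (hd.summable w).sum_add_tsum_nat_add m, ← tsum_mul_left,
    Finset.sum_eq_zero fun k hk => by rw [hm k (Finset.mem_range.1 hk), zero_mul], zero_add]
  exact tsum_congr fun k => by rw [pow_add]; ring

theorem EntireCoeff.cpow_isBigO_cpowSeries (hd : EntireCoeff d) (ν : ℂ) {m : ℕ}
    (hm : ∀ k < m, d k = 0) (hdm : d m ≠ 0) :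
    (fun t : ℝ => (t : ℂ) ^ (ν + 2 * m)) =O[𝓝[>] 0] cpowSeries ν d := by
  set q : ℂ → ℂ := fun w => ∑' k, d (k + m) * w ^ k
  have hq₀ : q 0 = d m := (tsum_eq_single 0 fun k hk => by simp [hk]).trans (by simp)
  have hlim : Tendsto (fun t : ℝ => q ((t : ℂ) ^ 2)) (𝓝[>] 0) (𝓝 (d m)) := by
    have hq : Continuous q := continuous_iff_continuousAt.2 fun w =>
      ((hd.comp_add_nat m).hasDerivAt_tsum w).continuousAt
    have hcont : Continuous fun t : ℝ => q ((t : ℂ) ^ 2) := by fun_prop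
    simpa [hq₀] using (hcont.tendsto 0).mono_left nhdsWithin_le_nhds
  have hprod := (isBigO_refl (cpowSeries ν d) (𝓝[>] 0)).mul
    ((hlim.inv₀ hdm).isBigO_one (F := ℂ))
  refine hprod.congr' ?_ (.of_eq (by simp))
  filter_upwards [hlim.eventually_ne hdm, self_mem_nhdsWithin] with t hqt (ht : 0 < t)
  rw [cpowSeries, hd.tsum_eq_pow_mul_tsum hm,
    cpow_add_two_mul_natCast ν m (by exact_mod_cast ht.ne'), ← mul_assoc,
    mul_inv_cancel_right₀ hqt]

theorem norm_cpow_sub_one_mul_le_of_le (g : ℝ → ℂ) {z s : ℂ} (hs : s.re ≤ z.re) {δ u : ℝ}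
    (hδ : 0 < δ) (hu : δ ≤ u) :
    ‖(u : ℂ) ^ (s - 1) * g u‖ ≤ δ ^ (s.re - z.re) * ‖(u : ℂ) ^ (z - 1) * g u‖ := by
  have hu₀ : 0 < u := hδ.trans_le hu
  have hsplit : u ^ (s.re - 1) = u ^ (s.re - z.re) * u ^ (z.re - 1) := by
    rw [← Real.rpow_add hu₀]; ring_nf
  rw [norm_mul, norm_mul, Complex.norm_cpow_eq_rpow_re_of_pos hu₀,
    Complex.norm_cpow_eq_rpow_re_of_pos hu₀, Complex.sub_re, Complex.sub_re, Complex.one_re,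
    hsplit, mul_assoc]
  exact mul_le_mul_of_nonneg_right (Real.rpow_le_rpow_of_nonpos hδ hu (sub_nonpos.2 hs))
    (by positivity)

theorem UnitMellinConvergent.of_isBigO (hg : UnitMellinConvergent g z)
    (hh : IntegrableOn h (Set.Ioo 0 1)) {s : ℂ}
    (hle : (fun u : ℝ => (u : ℂ) ^ (s - 1) * g u) =O[𝓝[>] 0] h) : UnitMellinConvergent g s := by
  rcases le_total z.re s.re with hs | hs
  · exact hg.of_re_le hs
  have hmeas := hg.aestronglyMeasurable s
  have hIoo : Set.Ioo (0 : ℝ) 1 ∈ 𝓝[>] 0 := Ioo_mem_nhdsGT zero_lt_one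
  obtain ⟨S, hS, hnear⟩ := hle.integrableAtFilter ⟨_, hIoo, hmeas⟩ ⟨_, hIoo, hh⟩
  obtain ⟨δ, hδ, hδS⟩ := mem_nhdsGT_iff_exists_Ioo_subset.1 hS
  have hfar : IntegrableOn (fun u : ℝ => (u : ℂ) ^ (s - 1) * g u)
      (Set.Ioo 0 1 ∩ Set.Ici δ) := by
    refine Integrable.mono'
      ((IntegrableOn.mono_set hg Set.inter_subset_left).norm.const_mul (δ ^ (s.re - z.re)))
      (hmeas.mono_measure (Measure.restrict_mono_set _ Set.inter_subset_left)) ?_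
    filter_upwards [ae_restrict_mem (measurableSet_Ioo.inter measurableSet_Ici)] with u hu
    exact norm_cpow_sub_one_mul_le_of_le g hs hδ hu.2
  refine ((hnear.mono_set hδS).union hfar).mono_set fun u hu => ?_
  exact (lt_or_ge u δ).imp (fun huδ => ⟨hu.1, huδ⟩) fun huδ => ⟨hu, huδ⟩

theorem unitMellinConvergent_of_integrableOn_mul_cpowSeries (hg : UnitMellinConvergent g z)
    (hd : EntireCoeff d) (σ : ℂ) {m : ℕ} (hm : ∀ k < m, d k = 0) (hdm : d m ≠ 0) {x : ℝ}
    (hx : 0 < x)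
    (hint : IntegrableOn (fun u : ℝ => g u * cpowSeries (σ - 1) d (x * u)) (Set.Ioo 0 1)) :
    UnitMellinConvergent g (σ + 2 * m) := by
  refine hg.of_isBigO hint ?_
  have hlim : Tendsto (fun u : ℝ => x * u) (𝓝[>] 0) (𝓝[>] 0) :=
    tendsto_iff_comap.2 (comap_mulLeft_nhdsGT_zero hx).ge
  have hbound := ((isBigO_refl g (𝓝[>] 0)).mul ((hd.cpow_isBigO_cpowSeries (σ - 1) hm
    hdm).comp_tendsto hlim)).const_mul_left ((x : ℂ) ^ (σ - 1 + 2 * m))⁻¹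
  have hpow : (x : ℂ) ^ (σ - 1 + 2 * m) ≠ 0 :=
    Complex.cpow_ne_zero_iff.2 (Or.inl (by exact_mod_cast hx.ne'))
  refine hbound.congr' ?_ .rfl
  filter_upwards [self_mem_nhdsWithin] with u (hu : 0 < u)
  simp only [Function.comp_apply, Complex.ofReal_mul, add_sub_right_comm,
    Complex.mul_cpow_ofReal_nonneg hx.le hu.le]
  field_simp

theorem exists_unitMellinConvergent_of_integrableOn_mul_cpowSeries
    (hg : UnitMellinConvergent g z) (hd : EntireCoeff d) (σ : ℂ) {x : ℝ} (hx : 0 < x)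
    (hint : IntegrableOn (fun u : ℝ => g u * cpowSeries (σ - 1) d (x * u)) (Set.Ioo 0 1)) :
    ∃ r : ℝ, UnitMellinConvergent g r ∧ ∀ k, d k ≠ 0 → r ≤ (σ + 2 * k).re := by
  classical
  by_cases hzero : ∀ k, d k = 0
  · exact ⟨z.re, hg.of_re_le (by simp), fun k hk => absurd (hzero k) hk⟩
  push Not at hzero
  have hmin : ∀ k < Nat.find hzero, d k = 0 := fun k hk => not_not.1 (Nat.find_min hzero hk)
  refine ⟨(σ + 2 * Nat.find hzero).re, ?_, fun k hk => ?_⟩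
  · exact (unitMellinConvergent_of_integrableOn_mul_cpowSeries hg hd σ hmin
      (Nat.find_spec hzero) hx hint).of_re_le (by simp)
  · simpa using Nat.find_min' hzero hk

end LeadingTerm

section EvenSeries

open MeasureTheory

variable {g : ℝ → ℂ} {d : ℕ → ℂ} {z : ℂ}

theorem EntireCoeff.hasSum_cpowSeries_mul (hd : EntireCoeff d) (σ : ℂ) {y u : ℝ} (hy : 0 < y)
    (hu : 0 < u) :
    HasSum (fun k : ℕ => (y : ℂ) ^ (σ - 1) * (d k * ((y : ℂ) ^ 2) ^ k) *
      (u : ℂ) ^ (σ + 2 * k - 1)) (cpowSeries (σ - 1) d (y * u)) := by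
  refine ((hd.summable (((y * u : ℝ) : ℂ) ^ 2)).hasSum.mul_left _).congr_fun fun k => ?_
  rw [add_sub_right_comm, cpow_add_two_mul_natCast _ _ (by exact_mod_cast hu.ne'),
    Complex.ofReal_mul, Complex.mul_cpow_ofReal_nonneg hy.le hu.le, mul_pow, mul_pow]
  ring

theorem EntireCoeff.mul_unitMellin (hd : EntireCoeff d) (hg : UnitMellinConvergent g z) (σ : ℂ)
    (hz : ∀ k, d k ≠ 0 → z.re ≤ (σ + 2 * k).re) :
    EntireCoeff fun k => d k * unitMellin g (σ + 2 * k) := by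
  refine hd.of_norm_le (Q := 1) zero_le_one
    (B := ∫ u in Set.Ioo (0 : ℝ) 1, ‖(u : ℂ) ^ (z - 1) * g u‖) fun k => ?_
  by_cases hk : d k = 0
  · simp [hk]
  · rw [norm_mul, one_pow, mul_one, mul_comm]
    gcongr
    exact (norm_integral_le_integral_norm _).trans (hg.integral_norm_le (hz k hk))

theorem hasSum_integral_mul_cpowSeries (hd : EntireCoeff d) (hg : UnitMellinConvergent g z) (σ : ℂ)
    (hz : ∀ k, d k ≠ 0 → z.re ≤ (σ + 2 * k).re) {y : ℝ} (hy : 0 < y) :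
    HasSum (fun k : ℕ => (y : ℂ) ^ (σ - 1) *
      (d k * unitMellin g (σ + 2 * k) * ((y : ℂ) ^ 2) ^ k))
      (∫ u in Set.Ioo (0 : ℝ) 1, g u * cpowSeries (σ - 1) d (y * u)) := by
  set F : ℕ → ℝ → ℂ := fun k u => (y : ℂ) ^ (σ - 1) * (d k * ((y : ℂ) ^ 2) ^ k) *
    ((u : ℂ) ^ (σ + 2 * k - 1) * g u) with hF
  have hFint : ∀ k, IntegrableOn (F k) (Set.Ioo 0 1) := by
    intro k
    by_cases hk : d k = 0
    · simp only [hF, hk, zero_mul, mul_zero, integrableOn_zero]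
    · exact (hg.of_re_le (hz k hk)).const_mul _
  have hFsummable : Summable fun k => ∫ u in Set.Ioo (0 : ℝ) 1, ‖F k u‖ := by
    refine Summable.of_nonneg_of_le (fun k => integral_nonneg fun _ => norm_nonneg _) (fun k => ?_)
      ((hd (y ^ 2) (by positivity)).mul_left
        (‖(y : ℂ) ^ (σ - 1)‖ * ∫ u in Set.Ioo (0 : ℝ) 1, ‖(u : ℂ) ^ (z - 1) * g u‖))
    simp only [hF, norm_mul _ (_ * g _), integral_const_mul]
    by_cases hk : d k = 0
    · simp [hk]
    · rw [norm_mul, norm_mul (d k), norm_pow, norm_pow, Complex.norm_real, Real.norm_eq_abs, sq_abs,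
        mul_right_comm]
      gcongr ?_ * ?_ * ?_
      exact hg.integral_norm_le (hz k hk)
  have hFsum : ∀ᵐ u : ℝ ∂volume.restrict (Set.Ioo 0 1),
      HasSum (fun k => F k u) (g u * cpowSeries (σ - 1) d (y * u)) := by
    filter_upwards [ae_restrict_mem measurableSet_Ioo] with u hu
    exact ((hd.hasSum_cpowSeries_mul σ hy hu.1).mul_left (g u)).congr_fun fun k => by ring
  refine (integrable_and_hasSum_integral hFint hFsummable hFsum).2.congr_fun fun k => ?_
  simp only [hF, integral_const_mul, unitMellin]
  ring

theorem mul_unitMellin_msmKernel {L L' X X' G σ : ℂ} {r : ℝ} {k : ℕ} (hG : 0 < G.re)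
    (hr : UnitMellinConvergent (msmKernel L L' X X' G) r)
    (hrd : d k ≠ 0 → r ≤ (σ + 2 * k).re) (hnum : msmGammaNum L L' X X' G (σ + 2 * k) ≠ 0) :
    d k * unitMellin (msmKernel L L' X X' G) (σ + 2 * k) = Complex.Gamma G *
      (d k * (msmGammaNum L L' X X' G (σ + 2 * k) / msmGammaDen L L' X X' G (σ + 2 * k))) := by
  by_cases hk : d k = 0
  · simp [hk]
  · rw [← mul_inv_cancel_right₀ hnum (unitMellin _ _), mul_right_comm (unitMellin _ _),
      unitMellin_msmKernel_mul_inv L L' X X' hG hr (hrd hk)]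
    ring

theorem MSMIntegralExists.eqOn_msmIntegral_cpowSeries {L L' X X' G σ : ℂ} {x : ℝ} (hx : 0 < x)
    (hf : MSMIntegralExists L L' X X' G (cpowSeries (σ - 1) d) x) (hG : 0 < G.re)
    (hd : EntireCoeff d) (hnum : ∀ k : ℕ, msmGammaNum L L' X X' G (σ + 2 * k) ≠ 0) :
    (EntireCoeff fun k => d k *
      (msmGammaNum L L' X X' G (σ + 2 * k) / msmGammaDen L L' X X' G (σ + 2 * k))) ∧
    Set.EqOn (msmIntegral L L' X X' G (cpowSeries (σ - 1) d))
      (cpowSeries (G - L - L' + σ - 1) fun k => d k *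
        (msmGammaNum L L' X X' G (σ + 2 * k) / msmGammaDen L L' X X' G (σ + 2 * k)))
      (Set.Ioi 0) := by
  have hΓ := Complex.Gamma_ne_zero_of_re_pos hG
  obtain ⟨T, hT⟩ := exists_unitMellin_msmKernel_of_le L L' X X' hG
  obtain ⟨r, hr, hrd⟩ := exists_unitMellinConvergent_of_integrableOn_mul_cpowSeries
    (hT T (by simp)).1 hd σ hx (hf.integrableOn_msmKernel_mul hx)
  have hcoeff := fun k => mul_unitMellin_msmKernel hG hr (hrd k) (hnum k)
  refine ⟨?_, fun y (hy : 0 < y) => ?_⟩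
  · simpa only [hcoeff, inv_mul_cancel_left₀ hΓ] using
      (hd.mul_unitMellin hr σ hrd).const_mul (Complex.Gamma G)⁻¹
  · have hsum := (hasSum_integral_mul_cpowSeries hd hr σ hrd hy).tsum_eq
    simp only [hcoeff, mul_assoc (Complex.Gamma G), tsum_mul_left] at hsum
    rw [msmIntegral_eq_integral_msmKernel_mul L L' X X' G _ hy, ← hsum, cpowSeries, add_sub_assoc,
      Complex.cpow_add _ _ (by exact_mod_cast hy.ne')]
    field_simp

end EvenSeries

section Main

/-- The coefficients of `t ^ (-(p + 1)) * W(t)`, with `W` the generalized Struve function, as a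
power series in `t ^ 2`. -/
noncomputable def struveCoeff (a : ℕ) (α : ℝ) (μ p b c : ℂ) (η : ℝ) (k : ℕ) : ℂ :=
  (-c / 4) ^ k * (Complex.Gamma (α * k + μ) * Complex.Gamma (a * k + (p / η + (b + 2) / 2)))⁻¹ /
    2 ^ (p + 1)

theorem entireCoeff_struveCoeff (a : ℕ) {α : ℝ} (hα : 0 < α) (μ p b c : ℂ) (η : ℝ) :
    EntireCoeff (struveCoeff a α μ p b c η) := by
  obtain ⟨C, hC⟩ := exists_norm_inv_Gamma_nat_mul_le a (p / η + (b + 2) / 2)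
  refine (entireCoeff_inv_Gamma hα μ).of_norm_le (B := C / ‖(2 : ℂ) ^ (p + 1)‖) (Q := ‖-c / 4‖)
    (norm_nonneg _) fun k => ?_
  calc ‖struveCoeff a α μ p b c η k‖
      = ‖-c / 4‖ ^ k * (‖(Complex.Gamma (α * k + μ))⁻¹‖ *
          ‖(Complex.Gamma (a * k + (p / η + (b + 2) / 2)))⁻¹‖) / ‖(2 : ℂ) ^ (p + 1)‖ := by
        rw [struveCoeff, norm_div, norm_mul, norm_pow, mul_inv, norm_mul]
    _ ≤ ‖-c / 4‖ ^ k * (‖(Complex.Gamma (α * k + μ))⁻¹‖ * C) / ‖(2 : ℂ) ^ (p + 1)‖ := by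
        gcongr
        exact hC k
    _ = C / ‖(2 : ℂ) ^ (p + 1)‖ * ‖-c / 4‖ ^ k * ‖(Complex.Gamma (α * k + μ))⁻¹‖ := by ring

theorem half_cpow_two_mul_natCast_add {t : ℝ} (ht : 0 < t) (p : ℂ) (k : ℕ) :
    ((t : ℂ) / 2) ^ (2 * k + p + 1) =
      (t : ℂ) ^ (p + 1) / 2 ^ (p + 1) * (((t : ℂ) ^ 2) ^ k / 4 ^ k) := by
  have hdiv : ((t : ℂ) / 2) ^ (p + 1) = (t : ℂ) ^ (p + 1) / 2 ^ (p + 1) := by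
    simpa using Complex.div_cpow_ofReal_nonneg ht.le zero_le_two (p + 1)
  rw [add_assoc, add_comm, cpow_add_two_mul_natCast _ _ (by simpa using ht.ne'), hdiv, div_pow,
    div_pow]
  norm_num

theorem cpow_mul_genStruve (a : ℕ) (α : ℝ) (μ p b c ρ : ℂ) (η : ℝ) {t : ℝ} (ht : 0 < t) :
    (t : ℂ) ^ (ρ - 1) * genStruve a α μ p b c η t =
      cpowSeries (ρ + p + 1 - 1) (struveCoeff a α μ p b c η) t := by
  rw [cpowSeries, show ρ + p + 1 - 1 = ρ - 1 + (p + 1) by ring,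
    Complex.cpow_add _ _ (by exact_mod_cast ht.ne'), genStruve, ← tsum_mul_left,
    ← tsum_mul_left]
  refine tsum_congr fun k => ?_
  rw [half_cpow_two_mul_natCast_add ht, struveCoeff, add_assoc ((a : ℂ) * k), div_pow]
  ring

section FoxWright

variable {l l' ξ ξ' γ ρ p : ℂ}

theorem msmGammaNum_neg (l l' ξ ξ' γ ρ p w s : ℂ) :
    msmGammaNum (-l') (-l) (-ξ' + w) (-ξ) (-γ + w) (ρ + p + 1 + s) =
      Complex.Gamma (ρ + p + 1 + s) * Complex.Gamma (-ξ + l + ρ + p + 1 + s) *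
        Complex.Gamma (l + l' + ξ' - γ + ρ + p + 1 + s) := by
  rw [msmGammaNum]
  ring_nf

theorem msmGammaDen_neg (l l' ξ ξ' γ ρ p w s : ℂ) :
    msmGammaDen (-l') (-l) (-ξ' + w) (-ξ) (-γ + w) (ρ + p + 1 + s) =
      Complex.Gamma (-ξ + ρ + p + 1 + s) * Complex.Gamma (l + l' - γ + ρ + p + 1 + s + w) *
        Complex.Gamma (l + ξ' - γ + ρ + p + 1 + s) := by
  rw [msmGammaDen]
  ring_nf

theorem FoxWrightTermsExist.msmGammaNum_ne_zero
    (hA : FoxWrightTermsExist (upperParams l l' ξ ξ' γ ρ p)) (w : ℂ) (k : ℕ) :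
    msmGammaNum (-l') (-l) (-ξ' + w) (-ξ) (-γ + w) (ρ + p + 1 + 2 * k) ≠ 0 := by
  rw [msmGammaNum_neg]
  refine mul_ne_zero (mul_ne_zero ?_ ?_) ?_ <;> refine Complex.Gamma_ne_zero fun j => ?_
  · simpa [upperParams] using hA 1 k j
  · simpa [upperParams] using hA 2 k j
  · simpa [upperParams] using hA 3 k j

theorem foxWrightTerm_upperParams_lowerParams (l l' ξ ξ' γ ρ p b μ : ℂ) (α η : ℝ) (a n : ℕ) (z : ℂ)
    (k : ℕ) :
    foxWrightTerm (upperParams l l' ξ ξ' γ ρ p) (lowerParams l l' ξ ξ' γ ρ p b μ α η a) z k =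
      poch (l + l' - γ + ρ + p + 1 + 2 * k) n *
        ((Complex.Gamma (α * k + μ) * Complex.Gamma (a * k + (p / η + (b + 2) / 2)))⁻¹ *
          (msmGammaNum (-l') (-l) (-ξ' + n) (-ξ) (-γ + n) (ρ + p + 1 + 2 * k) /
            msmGammaDen (-l') (-l) (-ξ' + n) (-ξ) (-γ + n) (ρ + p + 1 + 2 * k))) * z ^ k := by
  have hfact : (k.factorial : ℂ) ≠ 0 := by exact_mod_cast k.factorial_ne_zero
  have hΓ : Complex.Gamma (1 + k) = k.factorial := by
    rw [add_comm, Complex.Gamma_nat_eq_factorial]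
  rw [msmGammaNum_neg, msmGammaDen_neg]
  simp only [foxWrightTerm, upperParams, lowerParams, Fin.prod_univ_succ, Fin.prod_univ_zero,
    Matrix.cons_val_zero, Matrix.cons_val_succ, Complex.ofReal_one, Complex.ofReal_ofNat,
    Complex.ofReal_natCast, one_mul, mul_one, hΓ]
  rw [add_comm μ, add_comm (p / η + (b + 2) / 2) ((a : ℂ) * k)]
  simp only [div_eq_mul_inv, mul_inv, Gamma_inv_eq_poch_mul (l + l' - γ + ρ + p + 1 + 2 * k) n]
  field_simp

end FoxWright

theorem theorem3_general {l l' ξ ξ' γ ρ p b c μ : ℂ} {a n : ℕ} {α η x : ℝ} (hn : γ.re < n)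
    (hα : 0 < α) (_hη : η ≠ 0) (hx : 0 < x)
    (hleft : MSMIntegralExists (-l') (-l) (-ξ' + n) (-ξ) (-γ + n)
      (fun t : ℝ => (t : ℂ) ^ (ρ - 1) * genStruve a α μ p b c η t) x)
    (hright : FoxWrightTermsExist (upperParams l l' ξ ξ' γ ρ p)) :
    ContDiffAt ℝ n (msmIntegral (-l') (-l) (-ξ' + n) (-ξ) (-γ + n)
        fun t : ℝ => (t : ℂ) ^ (ρ - 1) * genStruve a α μ p b c η t) x ∧
      Summable (foxWrightTerm (upperParams l l' ξ ξ' γ ρ p)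
        (lowerParams l l' ξ ξ' γ ρ p b μ α η a) (-c * (x : ℂ) ^ 2 / 4)) ∧
      iteratedDeriv n (msmIntegral (-l') (-l) (-ξ' + n) (-ξ) (-γ + n)
          fun t : ℝ => (t : ℂ) ^ (ρ - 1) * genStruve a α μ p b c η t) x =
        (x : ℂ) ^ (l + l' - γ + ρ + p) / 2 ^ (p + 1) *
          foxWright (upperParams l l' ξ ξ' γ ρ p)
            (lowerParams l l' ξ ξ' γ ρ p b μ α η a) (-c * (x : ℂ) ^ 2 / 4) := by
  have hG : 0 < (-γ + n).re := by simpa using hn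
  have hstruve : Set.EqOn (fun t : ℝ => (t : ℂ) ^ (ρ - 1) * genStruve a α μ p b c η t)
      (cpowSeries (ρ + p + 1 - 1) (struveCoeff a α μ p b c η)) (Set.Ioi 0) :=
    fun t ht => cpow_mul_genStruve a α μ p b c ρ η ht
  obtain ⟨hcoeff, hint⟩ := (hleft.congr hstruve).eqOn_msmIntegral_cpowSeries hx hG
    (entireCoeff_struveCoeff a hα μ p b c η) (hright.msmGammaNum_ne_zero n)
  have hlocal := hint.eventuallyEq_of_mem (Ioi_mem_nhds hx)
  have hν : -γ + n - -l' - -l + (ρ + p + 1) - 1 - n = l + l' - γ + ρ + p := by ring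
  have hterm : ∀ k : ℕ, poch (l + l' - γ + ρ + p + 1 + 2 * k) n * (struveCoeff a α μ p b c η k *
      (msmGammaNum (-l') (-l) (-ξ' + n) (-ξ) (-γ + n) (ρ + p + 1 + 2 * k) /
        msmGammaDen (-l') (-l) (-ξ' + n) (-ξ) (-γ + n) (ρ + p + 1 + 2 * k))) * ((x : ℂ) ^ 2) ^ k =
      (2 ^ (p + 1))⁻¹ * foxWrightTerm (upperParams l l' ξ ξ' γ ρ p)
        (lowerParams l l' ξ ξ' γ ρ p b μ α η a) (-c * (x : ℂ) ^ 2 / 4) k := fun k => by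
    rw [foxWrightTerm_upperParams_lowerParams (n := n), struveCoeff, mul_div_right_comm (-c),
      mul_pow]
    ring
  rw [msmIntegral_congr _ _ _ _ _ hstruve]
  refine ⟨(hcoeff.contDiffAt_cpowSeries _ n hx).congr_of_eventuallyEq hlocal, ?_, ?_⟩
  · refine (((hcoeff.poch_mul (l + l' - γ + ρ + p + 1) n).summable ((x : ℂ) ^ 2)).mul_left
      (2 ^ (p + 1))).congr fun k => ?_
    rw [hterm, mul_inv_cancel_left₀ (by simp)]
  · rw [hlocal.iteratedDeriv_eq, hcoeff.iteratedDeriv_cpowSeries _ n hx, hν, cpowSeries,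
      tsum_congr hterm, tsum_mul_left, foxWright,
      div_eq_mul_inv _ ((2 : ℂ) ^ (p + 1)), mul_assoc]

end Main

theorem theorem3 (l l' ξ ξ' γ ρ p b c μ : ℂ) (a : ℕ) (α η : ℝ)
    (hγ : 0 < γ.re) (hα : 0 < α) (hη : 0 < η) (x : ℝ) (hx : 0 < x)
    (hleft : ∀ᶠ y in 𝓝 x, MSMDerivInnerExists l l' ξ ξ' γ
      (fun t : ℝ => (t : ℂ) ^ (ρ - 1) * genStruve a α μ p b c η t) y)
    (hright : FoxWrightTermsExist (upperParams l l' ξ ξ' γ ρ p)) :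
    ContDiffAt ℝ (msmOrder γ)
        (msmDerivInner l l' ξ ξ' γ
          (fun t : ℝ => (t : ℂ) ^ (ρ - 1) * genStruve a α μ p b c η t)) x ∧
      Summable (foxWrightTerm (upperParams l l' ξ ξ' γ ρ p)
        (lowerParams l l' ξ ξ' γ ρ p b μ α η a) (-c * (x : ℂ) ^ 2 / 4)) ∧
      msmDeriv l l' ξ ξ' γ
          (fun t : ℝ => (t : ℂ) ^ (ρ - 1) * genStruve a α μ p b c η t) x =
        (x : ℂ) ^ (l + l' - γ + ρ + p) / 2 ^ (p + 1) *
          foxWright (upperParams l l' ξ ξ' γ ρ p)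
            (lowerParams l l' ξ ξ' γ ρ p b μ α η a) (-c * (x : ℂ) ^ 2 / 4) := by
  have hn : γ.re < msmOrder γ := by
    simpa only [msmOrder, Nat.cast_succ] using Nat.lt_floor_add_one γ.re
  exact theorem3_general hn hα hη.ne' hx hleft.self_of_nhds hright
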